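/- Let $0<s<m<1$, put $q:=1+\frac1s-\frac1m$, and let $\mathcal L(s,m)$ be the fractal string that contains the length $2^{-q^k}$ exactly $\lfloor 2^{q^{k+1}s}\rfloor$ times for $k=1,2,\dots$; its total length $L=\sum_{k\ge1}\lfloor 2^{q^{k+1}s}\rfloor 2^{-q^k}$ is finite. A geometric realization of $\mathcal L(s,m)$ is a union $\Omega\subset\mathbb R$ of pairwise disjoint open intervals with exactly these lengths (counted with multiplicity), all contained in one open interval of length $L$. Such realizations exist; let $\Omega$ be any one of them, let $F=F(s,m):=\partial\Omega$, and for an integer $d\ge1$ let $F_d:=F\times[0,1]^{d-1}\subset\mathbb R^d$. For bounded $A\subset\mathbb R^d$ and $r>0$ let $A_r$ be the set of points at Euclidean distance at most $r$ from $A$, let $\lambda_d$ be the Lebesgue measure, $\mathcal H^{d-1}$ the $(d-1)$-dimensional Hausdorff measure, and $\kappa_t:=\pi^{t/2}/\Gamma(1+\frac t2)$. The lower and upper Minkowski dimensions $\underline{\dim}_M A$, $\overline{\dim}_M A$ are the infima of the $t\ge0$ for which the $\liminf$, respectively the $\limsup$, of $\lambda_d(A_r)/(\kappa_{d-t}r^{d-t})$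 as $r\to0^+$ is $0$. The lower and upper S-dimensions $\underline{\dim}_S A$, $\overline{\dim}_S A$ are the infima of the $t\in[0,d]$ for which the lower, respectively upper, S-content is $0$; here the lower and upper $t$-dimensional S-contents are the $\liminf$ and the $\limsup$ of $\mathcal H^{d-1}(\partial A_r)/((d-t)\kappa_{d-t}r^{d-1-t})$ as $r\to0^+$ if $0\le t<d$, and are $0$ by convention if $t=d$. Theorem. For all $0<s<m<1$, every integer $d\ge1$ and every such realization, $$\underline{\dim}_S F_d=s+d-1,\qquad \underline{\dim}_M F_d=m+d-1,\qquad \overline{\dim}_M F_d=\overline{\dim}_S F_d=sq+d-1=d+s-\frac sm .$$ -/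

import Mathlib

open Filter Topology MeasureTheory Set

namespace SDim

noncomputable section

/-- The constant `κ_t = π^{t/2} / Γ(1 + t/2)`; for natural `t` it is the volume of the unit ball
of `ℝ^t`. -/
def kappa (t : ℝ) : ℝ := Real.pi ^ (t / 2) / Real.Gamma (1 + t / 2)

/-- The surface area `ℋ^{d-1}(∂A)` of the boundary of `A ⊆ ℝ^d`, with the usual normalization
`κ_{d-1} 2^{-(d-1)}` of the Hausdorff measure (Mathlib's `μH` is not normalized).
For `d = 1` this is the number of boundary points. -/
def surfaceArea {d : ℕ} (A : Set (EuclideanSpace ℝ (Fin d))) : ENNReal :=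
  ENNReal.ofReal (kappa ((d : ℝ) - 1) / 2 ^ ((d : ℝ) - 1)) *
    Measure.hausdorffMeasure ((d : ℝ) - 1) (frontier A)

/-- The quotient `V(A_r) / (κ_{d-t} r^{d-t})`, where `A_r` is the closed `r`-parallel set. -/
def minkowskiQuotient {d : ℕ} (A : Set (EuclideanSpace ℝ (Fin d))) (t r : ℝ) : ENNReal :=
  volume (Metric.cthickening r A) / ENNReal.ofReal (kappa (d - t) * r ^ (d - t))

/-- The lower `t`-dimensional Minkowski content. -/
def lowerMinkowskiContent {d : ℕ} (t : ℝ) (A : Set (EuclideanSpace ℝ (Fin d))) : ENNReal :=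
  liminf (fun r : ℝ => minkowskiQuotient A t r) (𝓝[>] 0)

/-- The upper `t`-dimensional Minkowski content. -/
def upperMinkowskiContent {d : ℕ} (t : ℝ) (A : Set (EuclideanSpace ℝ (Fin d))) : ENNReal :=
  limsup (fun r : ℝ => minkowskiQuotient A t r) (𝓝[>] 0)

/-- The lower Minkowski dimension `inf {t ≥ 0 : lower content is 0}`. For bounded `A` the set is
nonempty: it contains every `t` with `d < t < d + 2`, where `κ_{d-t}` is still positive. -/
def lowerMinkowskiDim {d : ℕ} (A : Set (EuclideanSpace ℝ (Fin d))) : ℝ :=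
  sInf {t : ℝ | 0 ≤ t ∧ lowerMinkowskiContent t A = 0}

/-- The upper Minkowski dimension `inf {t ≥ 0 : upper content is 0}`. -/
def upperMinkowskiDim {d : ℕ} (A : Set (EuclideanSpace ℝ (Fin d))) : ℝ :=
  sInf {t : ℝ | 0 ≤ t ∧ upperMinkowskiContent t A = 0}

/-- The quotient `ℋ^{d-1}(∂A_r) / ((d-t) κ_{d-t} r^{d-1-t})`. -/
def sQuotient {d : ℕ} (A : Set (EuclideanSpace ℝ (Fin d))) (t r : ℝ) : ENNReal :=
  surfaceArea (Metric.cthickening r A) /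
    ENNReal.ofReal ((d - t) * kappa (d - t) * r ^ (d - 1 - t))

open Classical in
/-- The lower `t`-dimensional S-content for `0 ≤ t < d`; by convention it is `0` for `t = d`. -/
def lowerSContent {d : ℕ} (t : ℝ) (A : Set (EuclideanSpace ℝ (Fin d))) : ENNReal :=
  if t = d then 0 else liminf (fun r : ℝ => sQuotient A t r) (𝓝[>] 0)

open Classical in
/-- The upper `t`-dimensional S-content for `0 ≤ t < d`; by convention it is `0` for `t = d`. -/
def upperSContent {d : ℕ} (t : ℝ) (A : Set (EuclideanSpace ℝ (Fin d))) : ENNReal :=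
  if t = d then 0 else limsup (fun r : ℝ => sQuotient A t r) (𝓝[>] 0)

/-- The lower S-dimension; the S-contents are defined for `0 ≤ t ≤ d` only. -/
def lowerSDim {d : ℕ} (A : Set (EuclideanSpace ℝ (Fin d))) : ℝ :=
  sInf {t : ℝ | 0 ≤ t ∧ t ≤ d ∧ lowerSContent t A = 0}

/-- The upper S-dimension. -/
def upperSDim {d : ℕ} (A : Set (EuclideanSpace ℝ (Fin d))) : ℝ :=
  sInf {t : ℝ | 0 ≤ t ∧ t ≤ d ∧ upperSContent t A = 0}

/-- `q = 1 + 1/s - 1/m`. -/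
def q (s m : ℝ) : ℝ := 1 + 1 / s - 1 / m

/-- The multiplicity `[2^{q^{k+1} s}]` of the length `2^{-q^k}`. -/
def multiplicity (s m : ℝ) (k : ℕ) : ℕ := ⌊(2 : ℝ) ^ (q s m ^ (k + 1) * s)⌋₊

/-- The index set of the fractal string `ℒ(s,m)`: pairs `(k, i)` with `k = 1, 2, …` and
`i` running through `[2^{q^{k+1} s}]` values. (A geometric realization does not depend on the
order in which the lengths are listed.) -/
abbrev StringIndex (s m : ℝ) : Type := Σ k : ℕ+, Fin (multiplicity s m k)

/-- The fractal string `ℒ(s,m)`: the family of lengths in which `2^{-q^k}` occurs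
`[2^{q^{k+1} s}]` times, `k = 1, 2, …`. -/
def fractalString (s m : ℝ) (j : StringIndex s m) : ℝ := (2 : ℝ) ^ (-(q s m ^ (j.1 : ℕ)))

/-- `Ω` is a geometric realization of the family of lengths `l` inside an open interval of
length `L = ∑ l_j`: a union of pairwise disjoint open intervals `I_j = (u_j, u_j + l_j)`, all
contained in one open interval `(a, a + L)`. -/
def IsGeometricRealization {ι : Type} (l : ι → ℝ) (Ω : Set ℝ) : Prop :=
  ∃ (a L : ℝ) (u : ι → ℝ), HasSum l L ∧
    (∀ j, Ioo (u j) (u j + l j) ⊆ Ioo a (a + L)) ∧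
    Pairwise (fun i j => Disjoint (Ioo (u i) (u i + l i)) (Ioo (u j) (u j + l j))) ∧
    Ω = ⋃ j, Ioo (u j) (u j + l j)

/-- The product `F × [0,1]^{d-1} ⊆ ℝ^d` (for `d ≥ 1`). -/
def prodCube (d : ℕ) (F : Set ℝ) : Set (EuclideanSpace ℝ (Fin d)) :=
  {x | ∀ i : Fin d, if (i : ℕ) = 0 then x i ∈ F else x i ∈ Icc (0 : ℝ) 1}

end

end SDim

/-! Since the lengths add up to the length of the enclosing interval, `Ω` fills it up to a null set.
Hence `F` is null and equals the closed interval minus `Ω`, and the size of the parallel sets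
depends only on the lengths `l_j`, not on their order: `V(F_r)` is comparable to `r + ∑ min(l_j,
r)`, and the number of boundary points is governed by the number of gaps longer than `2r`.

Multiplying by the cube changes only constants, with `n = d - 1`. For volume this is a sandwich
between products. For surface, a gap longer than `2r` contributes a unit slice
(`card_le_surfaceArea`). Conversely the boundary splits into pieces, each a Lipschitz graph over a
coordinate hyperplane with constants depending on `n` only, and there are boundedly many plus two
per gap of length at least `2r / (n + 1)` (`frontier_subset_pieces`, `exists_surfaceArea_le`).

It remains to count. Write `ℓ_k = 2^{-q^k}`. The multiplicity is about `ℓ_k^{-sq} = ℓ_{k+1}^{-s}`.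
The gap count at scale `r` is about `r^{-sq}` when `r` is just below `ℓ_k`, and it stays constant
until `r` is near `ℓ_{k+1}`, where it is only `r^{-s}`; this gives the upper dimensions `sq` and the
lower S-dimension `s`. For volume, with `x = ℓ_{k+1}` and `x ≤ r < ℓ_k`, the long gaps give about
`x^{-s} r` and the gaps of length `x` give `x^{1-sq}`. The sum is smallest relative to powers of `r`
where the two balance, at `r = x^{s/m}`, and there it equals `r^{1-m}` up to a constant: the lower
Minkowski dimension is `m > s`. -/

namespace SDim

/-! ### Geometric realizations on the line. -/

/-- The intervals `(u_j, u_j + l_j)` are nonempty, pairwise disjoint, and fill `(a, a + L)` up to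
a set of measure zero. -/
structure IsPlacement {ι : Type} (l u : ι → ℝ) (a L : ℝ) : Prop where
  nonempty : Nonempty ι
  countable : Countable ι
  pos : ∀ j, 0 < l j
  hasSum : HasSum l L
  subset : ∀ j, Ioo (u j) (u j + l j) ⊆ Ioo a (a + L)
  disj : Pairwise (fun i j => Disjoint (Ioo (u i) (u i + l i)) (Ioo (u j) (u j + l j)))

theorem mem_cthickening_iff_infDist_le {X : Type*} [PseudoMetricSpace X] {s : Set X}
    (hs : s.Nonempty) {r : ℝ} (hr : 0 ≤ r) (x : X) :
    x ∈ Metric.cthickening r s ↔ Metric.infDist x s ≤ r := by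
  rw [Metric.mem_cthickening_iff, Metric.infDist,
    ENNReal.le_ofReal_iff_toReal_le (Metric.infEDist_ne_top hs) hr]

theorem infDist_eq_of_mem_frontier_cthickening {X : Type*} [PseudoMetricSpace X] {s : Set X}
    {r : ℝ} (hr : 0 ≤ r) {x : X} (hx : x ∈ frontier (Metric.cthickening r s)) :
    Metric.infDist x s = r := by
  have := Metric.frontier_cthickening_subset s hx
  rw [Metric.infDist, this, ENNReal.toReal_ofReal hr]

namespace IsPlacement

variable {ι : Type} {l u : ι → ℝ} {a L : ℝ}

/-- The union of the intervals of a placement. -/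
def union (l u : ι → ℝ) : Set ℝ := ⋃ j, Ioo (u j) (u j + l j)

theorem isOpen_union : IsOpen (union l u) := isOpen_iUnion fun _ => isOpen_Ioo

theorem union_subset (h : IsPlacement l u a L) : union l u ⊆ Ioo a (a + L) :=
  iUnion_subset h.subset

theorem length_pos (h : IsPlacement l u a L) : 0 < L := by
  obtain ⟨j⟩ := h.nonempty
  exact (h.pos j).trans_le (le_hasSum h.hasSum j fun i _ => (h.pos i).le)

theorem volume_union (h : IsPlacement l u a L) : volume (union l u) = ENNReal.ofReal L := by
  have := h.countable
  rw [union, measure_iUnion h.disj fun _ => measurableSet_Ioo, ← h.hasSum.tsum_eq,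
    ENNReal.ofReal_tsum_of_nonneg (fun j => (h.pos j).le) h.hasSum.summable]
  simp

/-- The gaps have total length `L`, the full length of the interval containing them. -/
theorem volume_diff (h : IsPlacement l u a L) : volume (Icc a (a + L) \ union l u) = 0 := by
  rw [measure_sdiff (h.union_subset.trans Ioo_subset_Icc_self)
    isOpen_union.measurableSet.nullMeasurableSet (by rw [h.volume_union]; simp), h.volume_union]
  simp

/-- A point of the open interval outside the closure would have a neighbourhood of positive measure
missing the union, against `volume_diff`. -/
theorem closure_union (h : IsPlacement l u a L) : closure (union l u) = Icc a (a + L) := by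
  have hL := h.length_pos
  apply Subset.antisymm
  · exact closure_minimal (h.union_subset.trans Ioo_subset_Icc_self) isClosed_Icc
  · have : Ioo a (a + L) \ closure (union l u) = ∅ := by
      rw [← (isOpen_Ioo.sdiff isClosed_closure).measure_eq_zero_iff volume]
      exact measure_mono_null (sdiff_subset_sdiff Ioo_subset_Icc_self subset_closure) h.volume_diff
    rw [← closure_Ioo (by linarith : a ≠ a + L)]
    exact closure_minimal (sdiff_eq_empty.1 this) isClosed_closure

theorem frontier_union (h : IsPlacement l u a L) :
    frontier (union l u) = Icc a (a + L) \ union l u := by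
  rw [isOpen_union.frontier_eq, h.closure_union]

theorem volume_frontier (h : IsPlacement l u a L) : volume (frontier (union l u)) = 0 := by
  rw [h.frontier_union, h.volume_diff]

theorem left_mem (h : IsPlacement l u a L) : a ∈ frontier (union l u) := by
  have hL := h.length_pos
  rw [h.frontier_union]
  exact ⟨⟨le_rfl, by linarith⟩, fun H => lt_irrefl _ (h.union_subset H).1⟩

theorem right_mem (h : IsPlacement l u a L) : a + L ∈ frontier (union l u) := by
  have hL := h.length_pos
  rw [h.frontier_union]
  exact ⟨⟨by linarith, le_rfl⟩, fun H => lt_irrefl _ (h.union_subset H).2⟩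

theorem gap_subset (h : IsPlacement l u a L) (j : ι) :
    Icc (u j) (u j + l j) ⊆ Icc a (a + L) := by
  rw [← closure_Ioo (by linarith [h.pos j] : u j ≠ u j + l j)]
  exact closure_minimal ((h.subset j).trans Ioo_subset_Icc_self) isClosed_Icc

/-- If the endpoint lay in another gap, the two gaps would overlap just to its right. -/
theorem gap_left_mem (h : IsPlacement l u a L) (j : ι) : u j ∈ frontier (union l u) := by
  have hj := h.pos j
  rw [h.frontier_union]
  refine ⟨h.gap_subset j ⟨le_rfl, by linarith⟩, fun H => ?_⟩
  obtain ⟨i, hi⟩ := mem_iUnion.1 H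
  have hij : i ≠ j := by rintro rfl; exact lt_irrefl _ hi.1
  have h1 := h.pos i
  have hlt : u j < min (u i + l i) (u j + l j) := lt_min hi.2 (by linarith)
  obtain ⟨x, hx1, hx2⟩ := exists_between hlt
  exact (h.disj hij).le_bot
    ⟨⟨hi.1.trans hx1, hx2.trans_le (min_le_left _ _)⟩, hx1, hx2.trans_le (min_le_right _ _)⟩

theorem gap_right_mem (h : IsPlacement l u a L) (j : ι) :
    u j + l j ∈ frontier (union l u) := by
  have hj := h.pos j
  rw [h.frontier_union]
  refine ⟨h.gap_subset j ⟨by linarith, le_rfl⟩, fun H => ?_⟩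
  obtain ⟨i, hi⟩ := mem_iUnion.1 H
  have hij : i ≠ j := by rintro rfl; exact lt_irrefl _ hi.2
  have h1 := h.pos i
  have hlt : max (u i) (u j) < u j + l j := max_lt hi.1 (by linarith)
  obtain ⟨x, hx1, hx2⟩ := exists_between hlt
  exact (h.disj hij).le_bot
    ⟨⟨(le_max_left _ _).trans_lt hx1, hx2.trans hi.2⟩, (le_max_right _ _).trans_lt hx1, hx2⟩

/-- A lower bound for the distance to the frontier inside a gap. -/
theorem min_le_infDist (h : IsPlacement l u a L) (j : ι) (x : ℝ) :
    min (x - u j) (u j + l j - x) ≤ Metric.infDist x (frontier (union l u)) := by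
  rw [Metric.le_infDist ⟨a, h.left_mem⟩]
  intro y hy
  rw [h.frontier_union] at hy
  have hyj : y ∉ Ioo (u j) (u j + l j) := fun H => hy.2 (mem_iUnion.2 ⟨j, H⟩)
  rw [Real.dist_eq]
  rcases le_or_gt y (u j) with h1 | h1
  · exact (min_le_left _ _).trans (by linarith [le_abs_self (x - y)])
  · have h2 : u j + l j ≤ y := not_lt.1 fun h2 => hyj ⟨h1, h2⟩
    exact (min_le_right _ _).trans (by linarith [neg_abs_le (x - y)])

/-- A point at positive distance from the frontier lies at this distance from an outer endpoint,
or from an endpoint of a gap which is at least twice as long. -/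
theorem infDist_cases (h : IsPlacement l u a L) {x : ℝ} {δ : ℝ}
    (hδ : Metric.infDist x (frontier (union l u)) = δ) (hpos : 0 < δ) :
    x = a - δ ∨ x = a + L + δ ∨ ∃ j, 2 * δ ≤ l j ∧ (x = u j + δ ∨ x = u j + l j - δ) := by
  have hne : (frontier (union l u)).Nonempty := ⟨a, h.left_mem⟩
  have hle : ∀ y ∈ frontier (union l u), δ ≤ |x - y| := fun y hy =>
    hδ ▸ Metric.infDist_le_dist_of_mem hy
  by_cases hx : x ∈ union l u
  · obtain ⟨j, hj⟩ := mem_iUnion.1 hx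
    have h1 := hle _ (h.gap_left_mem j)
    have h2 := hle _ (h.gap_right_mem j)
    have h3 := h.min_le_infDist j x
    rw [abs_of_pos (by linarith [hj.1])] at h1
    rw [abs_of_neg (by linarith [hj.2])] at h2
    rw [hδ] at h3
    refine Or.inr (Or.inr ⟨j, by linarith, ?_⟩)
    rcases min_le_iff.1 h3 with h4 | h4
    · left; linarith
    · right; linarith
  · have hF : x ∉ frontier (union l u) := fun H => by
      rw [Metric.infDist_zero_of_mem H] at hδ; linarith
    rw [h.frontier_union] at hF
    have hI : x ∉ Icc a (a + L) := fun H => hF ⟨H, hx⟩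
    rcases lt_or_ge x a with h1 | h1
    · left
      have h2 := hle _ h.left_mem
      rw [abs_of_neg (by linarith)] at h2
      have : a - x ≤ δ := by
        rw [← hδ, Metric.le_infDist hne]
        intro y hy
        rw [h.frontier_union] at hy
        rw [Real.dist_eq]
        linarith [neg_abs_le (x - y), hy.1.1]
      linarith
    · right; left
      have h3 : a + L < x := not_le.1 fun h3 => hI ⟨h1, h3⟩
      have h2 := hle _ h.right_mem
      rw [abs_of_pos (by linarith)] at h2
      have : x - (a + L) ≤ δ := by
        rw [← hδ, Metric.le_infDist hne]
        intro y hy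
        rw [h.frontier_union] at hy
        rw [Real.dist_eq]
        linarith [le_abs_self (x - y), hy.1.2]
      linarith

theorem infDist_le_imp_mem_Icc (h : IsPlacement l u a L) {x r : ℝ}
    (hx : Metric.infDist x (frontier (union l u)) ≤ r) : x ∈ Icc (a - r) (a + L + r) := by
  obtain ⟨y, hy, hxy⟩ := isClosed_frontier.exists_infDist_eq_dist ⟨a, h.left_mem⟩ x
  rw [hxy, Real.dist_eq, abs_le] at hx
  rw [h.frontier_union] at hy
  exact ⟨by linarith [hx.1, hy.1.1], by linarith [hx.2, hy.1.2]⟩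

/-- The length of the parallel set of the frontier is at least `∑ min(l_j, r)`. -/
theorem sum_min_le_volume (h : IsPlacement l u a L) {r : ℝ} (J : Finset ι) :
    ∑ j ∈ J, ENNReal.ofReal (min (l j) r) ≤
      volume (Metric.cthickening r (frontier (union l u))) := by
  have hsub : ∀ j, Ioo (u j) (u j + min (l j) r) ⊆ Ioo (u j) (u j + l j) := fun j =>
    Ioo_subset_Ioo_right (by linarith [min_le_left (l j) r])
  calc ∑ j ∈ J, ENNReal.ofReal (min (l j) r)
      = volume (⋃ j ∈ J, Ioo (u j) (u j + min (l j) r)) := by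
        rw [measure_biUnion_finset]
        · simp
        · exact fun i _ j _ hij => (h.disj hij).mono (hsub i) (hsub j)
        · exact fun _ _ => measurableSet_Ioo
    _ ≤ _ := by
        refine measure_mono (iUnion₂_subset fun j _ x hx => ?_)
        refine Metric.mem_cthickening_of_dist_le x (u j) _ _ (h.gap_left_mem j) ?_
        rw [Real.dist_eq, abs_of_pos (by linarith [hx.1])]
        linarith [hx.2, min_le_right (l j) r]

/-- The length of the parallel set of the frontier is at most `2r + ∑ min(l_j, 2r)`. -/
theorem volume_le (h : IsPlacement l u a L) {r : ℝ} (hr : 0 < r) {w : ι → ℝ}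
    (hw : ∀ j, min (l j) (2 * r) ≤ w j) (hs : Summable w) :
    volume (Metric.cthickening r (frontier (union l u))) ≤
      ENNReal.ofReal (2 * r + ∑' j, w j) := by
  have := h.countable
  have hw0 : ∀ j, 0 ≤ w j := fun j => (le_min (h.pos j).le (by linarith)).trans (hw j)
  -- Two outer collars of width `r`, the null set `F` itself, and in each gap the two collars at its
  -- ends.
  have hsub : Metric.cthickening r (frontier (union l u)) ⊆
      (Icc (a - r) a ∪ Icc (a + L) (a + L + r)) ∪ (frontier (union l u) ∪
        ⋃ j, Ioo (u j) (u j + l j) ∩ (Icc (u j) (u j + r) ∪ Icc (u j + l j - r) (u j + l j))) := by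
    intro x hx
    rw [mem_cthickening_iff_infDist_le ⟨a, h.left_mem⟩ hr.le] at hx
    have h1 := h.infDist_le_imp_mem_Icc hx
    by_cases hxu : x ∈ union l u
    · right; right
      obtain ⟨j, hj⟩ := mem_iUnion.1 hxu
      refine mem_iUnion.2 ⟨j, hj, ?_⟩
      rcases min_le_iff.1 ((h.min_le_infDist j x).trans hx) with h2 | h2
      · exact Or.inl ⟨hj.1.le, by linarith⟩
      · exact Or.inr ⟨by linarith, hj.2.le⟩
    · rcases lt_or_ge x a with h2 | h2
      · exact Or.inl (Or.inl ⟨h1.1, h2.le⟩)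
      · rcases lt_or_ge (a + L) x with h3 | h3
        · exact Or.inl (Or.inr ⟨h3.le, h1.2⟩)
        · right; left
          rw [h.frontier_union]
          exact ⟨⟨h2, h3⟩, hxu⟩
  have hgap : ∀ j, volume (Ioo (u j) (u j + l j) ∩
      (Icc (u j) (u j + r) ∪ Icc (u j + l j - r) (u j + l j))) ≤ ENNReal.ofReal (w j) := by
    intro j
    refine le_trans ?_ (ENNReal.ofReal_le_ofReal (hw j))
    rw [ENNReal.ofReal_min]
    refine le_min ((measure_mono inter_subset_left).trans (by simp)) ?_
    refine (measure_mono inter_subset_right).trans ((measure_union_le _ _).trans ?_)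
    rw [Real.volume_Icc, Real.volume_Icc, ← ENNReal.ofReal_add (by linarith) (by linarith)]
    exact ENNReal.ofReal_le_ofReal (by linarith)
  refine (measure_mono hsub).trans ((measure_union_le _ _).trans ?_)
  rw [ENNReal.ofReal_add (by linarith) (tsum_nonneg hw0), ENNReal.ofReal_tsum_of_nonneg hw0 hs]
  refine add_le_add ((measure_union_le _ _).trans ?_) ((measure_union_le _ _).trans ?_)
  · rw [Real.volume_Icc, Real.volume_Icc, ← ENNReal.ofReal_add (by linarith) (by linarith)]
    exact ENNReal.ofReal_le_ofReal (by linarith)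
  · rw [h.volume_frontier, zero_add]
    exact (measure_iUnion_le _).trans (ENNReal.tsum_le_tsum hgap)

end IsPlacement

/-! ### Parallel sets of products and their Lipschitz boundary pieces. -/

/-- The product of the sets `S i` as a subset of Euclidean space. -/
def box {ι : Type*} [Fintype ι] (S : ι → Set ℝ) : Set (EuclideanSpace ℝ ι) := {x | ∀ i, x i ∈ S i}

theorem volume_box {ι : Type*} [Fintype ι] (S : ι → Set ℝ) :
    volume (box S) = ∏ i, volume (S i) := by
  have h := (EuclideanSpace.volume_preserving_symm_measurableEquiv_toLp ι).measure_preimage_equiv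
    (Set.univ.pi S)
  rw [volume_pi_pi] at h
  rw [← h]
  congr 1
  ext x
  simp [box]

/-- Coordinatewise nearest points, which exist because the factors are closed, assemble to a nearest
point of the product. -/
theorem infDist_box {ι : Type*} [Fintype ι] {S : ι → Set ℝ} (hc : ∀ i, IsClosed (S i))
    (hne : ∀ i, (S i).Nonempty) (z : EuclideanSpace ℝ ι) :
    Metric.infDist z (box S) = √(∑ i, Metric.infDist (z i) (S i) ^ 2) := by
  choose y hy hyd using fun i => (hc i).exists_infDist_eq_dist (hne i) (z i)
  have hmem : WithLp.toLp 2 y ∈ box S := hy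
  apply le_antisymm
  · refine (Metric.infDist_le_dist_of_mem hmem).trans_eq ?_
    rw [EuclideanSpace.dist_eq]
    simp only [hyd]
  · rw [Metric.le_infDist ⟨_, hmem⟩]
    intro p hp
    rw [EuclideanSpace.dist_eq]
    refine Real.sqrt_le_sqrt (Finset.sum_le_sum fun i _ => ?_)
    exact pow_le_pow_left₀ Metric.infDist_nonneg (Metric.infDist_le_dist_of_mem (hp i)) 2

theorem infDist_box_sq {ι : Type*} [Fintype ι] {S : ι → Set ℝ} (hc : ∀ i, IsClosed (S i))
    (hne : ∀ i, (S i).Nonempty) (z : EuclideanSpace ℝ ι) :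
    ∑ i, Metric.infDist (z i) (S i) ^ 2 = Metric.infDist z (box S) ^ 2 := by
  rw [infDist_box hc hne, Real.sq_sqrt (Finset.sum_nonneg fun _ _ => sq_nonneg _)]

theorem infDist_coord_le {ι : Type*} [Fintype ι] {S : ι → Set ℝ} (hc : ∀ i, IsClosed (S i))
    (hne : ∀ i, (S i).Nonempty) (z : EuclideanSpace ℝ ι) (i : ι) :
    Metric.infDist (z i) (S i) ≤ Metric.infDist z (box S) := by
  rw [infDist_box hc hne]
  refine Real.le_sqrt_of_sq_le ?_
  exact Finset.single_le_sum (f := fun i => Metric.infDist (z i) (S i) ^ 2)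
    (fun _ _ => sq_nonneg _) (Finset.mem_univ i)

theorem abs_le_of_infDist_le {S : Set ℝ} (hc : IsClosed S) (hne : S.Nonempty) {R r x : ℝ}
    (hR : S ⊆ Icc (-R) R) (hx : Metric.infDist x S ≤ r) : x ∈ Icc (-(R + r)) (R + r) := by
  obtain ⟨y, hy, hxy⟩ := hc.exists_infDist_eq_dist hne x
  rw [hxy, Real.dist_eq, abs_le] at hx
  have := hR hy
  exact ⟨by linarith [hx.1, this.1], by linarith [hx.2, this.2]⟩

/-- The part of the boundary of a parallel set of `box S` whose `i`-th coordinate differs from `c`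
by `σ` times the (not too small) distance to `S i`. -/
def boundaryPiece {n : ℕ} (S : Fin (n + 1) → Set ℝ) (r : ℝ) (i : Fin (n + 1)) (c σ : ℝ) :
    Set (EuclideanSpace ℝ (Fin (n + 1))) :=
  {z | Metric.infDist z (box S) = r ∧ r ≤ (n + 1) * Metric.infDist (z i) (S i) ∧
    z i = c + σ * Metric.infDist (z i) (S i)}

theorem abs_infDist_sub_le (S : Set ℝ) (x y : ℝ) :
    |Metric.infDist x S - Metric.infDist y S| ≤ |x - y| := by
  simpa [Real.dist_eq] using (Metric.lipschitz_infDist_pt S).dist_le_mul x y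

/-- On the piece the squared coordinate distances sum to `r ^ 2`, so `δ i ^ 2` varies by at most `n
* D * 2r` when the other coordinates move by at most `D`. As `δ i + δ' i ≥ 2r / (n + 1)`, dividing
costs only a factor `n + 1` and `r` cancels. The constant is `(n + 1) * n` from coordinate `i` plus
`n` from the others. -/
theorem dist_le_of_mem_boundaryPiece {n : ℕ} {S : Fin (n + 1) → Set ℝ}
    (hc : ∀ i, IsClosed (S i)) (hne : ∀ i, (S i).Nonempty) {r : ℝ} (hr : 0 < r)
    {i : Fin (n + 1)} {c σ : ℝ} (hσ : |σ| = 1) {z z' : EuclideanSpace ℝ (Fin (n + 1))}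
    (hz : z ∈ boundaryPiece S r i c σ) (hz' : z' ∈ boundaryPiece S r i c σ) :
    dist z z' ≤ ((n * (n + 2) : ℕ) : ℝ) *
      dist (fun j => z (i.succAbove j)) (fun j => z' (i.succAbove j)) := by
  set D := dist (fun j => z (i.succAbove j)) (fun j => z' (i.succAbove j)) with hD
  have hD0 : 0 ≤ D := dist_nonneg
  have hj : ∀ j : Fin n, |z (i.succAbove j) - z' (i.succAbove j)| ≤ D := fun j => by
    rw [← Real.dist_eq]
    exact dist_le_pi_dist (fun j => z (i.succAbove j)) (fun j => z' (i.succAbove j)) j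
  obtain ⟨h1, h2, h3⟩ := hz
  obtain ⟨h1', h2', h3'⟩ := hz'
  have hle : ∀ k, Metric.infDist (z k) (S k) ≤ r := fun k => h1 ▸ infDist_coord_le hc hne z k
  have hle' : ∀ k, Metric.infDist (z' k) (S k) ≤ r := fun k => h1' ▸ infDist_coord_le hc hne z' k
  replace h1 := h1 ▸ infDist_box_sq hc hne z
  replace h1' := h1' ▸ infDist_box_sq hc hne z'
  rw [Fin.sum_univ_succAbove _ i] at h1 h1'
  set δ : Fin (n + 1) → ℝ := fun k => Metric.infDist (z k) (S k) with hδ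
  set δ' : Fin (n + 1) → ℝ := fun k => Metric.infDist (z' k) (S k) with hδ'
  have hdiff : ∀ k, |δ k - δ' k| ≤ |z k - z' k| := fun k => abs_infDist_sub_le _ _ _
  have e1 : |∑ j : Fin n, (δ' (i.succAbove j) ^ 2 - δ (i.succAbove j) ^ 2)| ≤ n * (D * (2 * r)) := by
    refine (Finset.abs_sum_le_sum_abs _ _).trans ?_
    refine (Finset.sum_le_card_nsmul _ _ (D * (2 * r)) fun j _ => ?_).trans_eq (by simp)
    have p1 : 0 ≤ δ (i.succAbove j) := Metric.infDist_nonneg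
    have p2 : 0 ≤ δ' (i.succAbove j) := Metric.infDist_nonneg
    have p3 := hle (i.succAbove j)
    have p4 := hle' (i.succAbove j)
    rw [sq_sub_sq, mul_comm, abs_mul, abs_of_nonneg (add_nonneg p2 p1), abs_sub_comm]
    exact mul_le_mul ((hdiff _).trans (hj j)) (by simp only [hδ, hδ']; linarith)
      (add_nonneg p2 p1) hD0
  have e2 : |δ i - δ' i| * (2 * r) ≤ (n + 1) * (n * (D * (2 * r))) := by
    have q1 : 0 ≤ δ i := Metric.infDist_nonneg
    have q2 : 0 ≤ δ' i := Metric.infDist_nonneg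
    have q3 : |δ i - δ' i| * (δ i + δ' i) ≤ n * (D * (2 * r)) := by
      refine le_trans (le_of_eq ?_) e1
      rw [← abs_of_nonneg (add_nonneg q1 q2), ← abs_mul, Finset.sum_sub_distrib]
      congr 1
      simp only [hδ, hδ']
      linarith
    have q4 : 2 * r ≤ (n + 1) * (δ i + δ' i) := by simp only [hδ, hδ']; linarith
    calc |δ i - δ' i| * (2 * r) ≤ |δ i - δ' i| * ((n + 1) * (δ i + δ' i)) := by gcongr
      _ = (n + 1) * (|δ i - δ' i| * (δ i + δ' i)) := by ring
      _ ≤ _ := by gcongr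
  have e3 : |z i - z' i| ≤ (n + 1) * n * D := by
    have : z i - z' i = σ * (δ i - δ' i) := by
      rw [h3, h3']; ring
    rw [this, abs_mul, hσ, one_mul]
    refine le_of_mul_le_mul_right (e2.trans_eq ?_) (by linarith : 0 < 2 * r)
    ring
  have e4 : dist z z' ≤ ∑ k, |z k - z' k| := by
    rw [EuclideanSpace.dist_eq]
    simp only [Real.dist_eq]
    refine Real.sqrt_le_iff.2 ⟨Finset.sum_nonneg fun _ _ => abs_nonneg _, ?_⟩
    exact Finset.sum_sq_le_sq_sum_of_nonneg fun _ _ => abs_nonneg _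
  refine e4.trans ?_
  rw [Fin.sum_univ_succAbove _ i]
  have e5 : ∑ j : Fin n, |z (i.succAbove j) - z' (i.succAbove j)| ≤ n * D :=
    (Finset.sum_le_card_nsmul _ _ D fun j _ => hj j).trans_eq (by simp)
  push_cast
  linarith

/-- Dropping coordinate `i` is antilipschitz on the piece, with image in a cube of side `2 * (R +
1)`. In the sup metric the `n`-dimensional Hausdorff measure is Lebesgue measure. The bound does not
depend on `r` or `c`. -/
theorem hausdorffMeasure_boundaryPiece_le {n : ℕ} {S : Fin (n + 1) → Set ℝ}
    (hc : ∀ i, IsClosed (S i)) (hne : ∀ i, (S i).Nonempty) {R : ℝ}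
    (hR : ∀ i, S i ⊆ Icc (-R) R) {r : ℝ} (hr : 0 < r) (hr1 : r ≤ 1)
    (i : Fin (n + 1)) (c : ℝ) {σ : ℝ} (hσ : |σ| = 1) :
    Measure.hausdorffMeasure (n : ℝ) (boundaryPiece S r i c σ) ≤
      ((n * (n + 2) : ℕ) : ENNReal) ^ n * ENNReal.ofReal (2 * (R + 1)) ^ n := by
  set P := boundaryPiece S r i c σ
  let f : P → (Fin n → ℝ) := fun z j => z.1 (i.succAbove j)
  have hf : AntilipschitzWith (n * (n + 2) : ℕ) f :=
    AntilipschitzWith.of_le_mul_dist fun z z' => by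
      rw [NNReal.coe_natCast]
      exact dist_le_of_mem_boundaryPiece hc hne hr hσ z.2 z'.2
  have h1 : Measure.hausdorffMeasure (n : ℝ) P =
      Measure.hausdorffMeasure (n : ℝ) (univ : Set P) := by
    rw [← (isometry_subtype_coe (s := P)).hausdorffMeasure_image (Or.inl n.cast_nonneg) univ]
    simp
  rw [h1]
  refine (hf.le_hausdorffMeasure_image n.cast_nonneg univ).trans ?_
  have h2 : Measure.hausdorffMeasure (n : ℝ) = (volume : Measure (Fin n → ℝ)) := by
    simpa using hausdorffMeasure_pi_real (ι := Fin n)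
  rw [h2, ENNReal.rpow_natCast]
  refine mul_le_mul (by simp) ?_ zero_le zero_le
  have h3 : f '' univ ⊆ Icc (fun _ => -(R + 1)) (fun _ => R + 1) := by
    rintro _ ⟨z, -, rfl⟩
    have h4 : ∀ j, z.1 j ∈ Icc (-(R + 1)) (R + 1) := fun j =>
      abs_le_of_infDist_le (hc j) (hne j) (hR j)
        ((infDist_coord_le hc hne z.1 j).trans (z.2.1.le.trans hr1))
    exact ⟨fun j => (h4 _).1, fun j => (h4 _).2⟩
  refine (measure_mono h3).trans_eq ?_
  rw [Real.volume_Icc_pi]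
  simp only [Finset.prod_const, Finset.card_univ, Fintype.card_fin]
  congr 2
  ring

/-- Otherwise the squared distances would sum to less than `r ^ 2 / (n + 1)`. -/
theorem exists_le_infDist_coord {n : ℕ} {S : Fin (n + 1) → Set ℝ}
    (hc : ∀ i, IsClosed (S i)) (hne : ∀ i, (S i).Nonempty) {r : ℝ} (hr : 0 < r)
    {z : EuclideanSpace ℝ (Fin (n + 1))} (hz : Metric.infDist z (box S) = r) :
    ∃ i, r ≤ (n + 1) * Metric.infDist (z i) (S i) := by
  by_contra! H
  replace hz := hz ▸ infDist_box_sq hc hne z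
  have h1 : ∀ i, Metric.infDist (z i) (S i) ^ 2 < (r / (n + 1)) ^ 2 := fun i => by
    refine pow_lt_pow_left₀ ?_ Metric.infDist_nonneg two_ne_zero
    rw [lt_div_iff₀ (by positivity)]
    linarith [H i]
  have h2 := Finset.sum_lt_sum_of_nonempty (Finset.univ_nonempty (α := Fin (n + 1)))
    fun i _ => h1 i
  rw [hz] at h2
  simp only [Finset.sum_const, Finset.card_univ, Fintype.card_fin, nsmul_eq_mul] at h2
  have h3 : ((n + 1 : ℕ) : ℝ) * (r / (n + 1)) ^ 2 = r ^ 2 / (n + 1) := by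
    push_cast; field_simp
  rw [h3, lt_div_iff₀ (by positivity)] at h2
  nlinarith [sq_nonneg r, (n.cast_nonneg : (0 : ℝ) ≤ n)]

/-! ### The product of a closed set with a unit cube. -/

/-- The factors of `prodCube`. -/
def side (F : Set ℝ) {n : ℕ} (i : Fin (n + 1)) : Set ℝ := if i = 0 then F else Icc 0 1

@[simp] theorem side_zero (F : Set ℝ) {n : ℕ} : side F (0 : Fin (n + 1)) = F := if_pos rfl

@[simp] theorem side_succ (F : Set ℝ) {n : ℕ} (j : Fin n) : side F j.succ = Icc 0 1 :=
  if_neg (Fin.succ_ne_zero j)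

theorem prodCube_eq_box (n : ℕ) (F : Set ℝ) : prodCube (n + 1) F = box (side F) := by
  ext x
  simp only [prodCube, box, mem_ofPred_eq, side]
  refine forall_congr' fun i => ?_
  by_cases hi : i = 0
  · simp [hi]
  · have : (i : ℕ) ≠ 0 := fun h => hi (Fin.ext h)
    simp [hi, this]

theorem isClosed_side {F : Set ℝ} (hF : IsClosed F) {n : ℕ} (i : Fin (n + 1)) :
    IsClosed (side F i) := by
  rw [side]; split_ifs; exacts [hF, isClosed_Icc]

theorem nonempty_side {F : Set ℝ} (hF : F.Nonempty) {n : ℕ} (i : Fin (n + 1)) :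
    (side F i).Nonempty := by
  rw [side]; split_ifs; exacts [hF, ⟨0, by simp⟩]

theorem nonempty_box {ι : Type*} [Fintype ι] {S : ι → Set ℝ} (h : ∀ i, (S i).Nonempty) :
    (box S).Nonempty := by
  choose y hy using h
  exact ⟨WithLp.toLp 2 y, hy⟩

theorem infDist_Icc_cases {x δ : ℝ} (hδ : Metric.infDist x (Icc 0 1) = δ) (hpos : 0 < δ) :
    x = 0 - δ ∨ x = 1 + δ := by
  have hne : (Icc (0 : ℝ) 1).Nonempty := ⟨0, by simp⟩
  have hle : ∀ y ∈ Icc (0 : ℝ) 1, δ ≤ |x - y| := fun y hy =>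
    hδ ▸ Metric.infDist_le_dist_of_mem hy
  have hI : x ∉ Icc (0 : ℝ) 1 := fun H => by
    rw [Metric.infDist_zero_of_mem H] at hδ; linarith
  rcases lt_or_ge x 0 with h1 | h1
  · left
    have h2 := hle 0 (by simp)
    rw [abs_of_neg (by linarith)] at h2
    have : -x ≤ δ := by
      rw [← hδ, Metric.le_infDist hne]
      intro y hy
      rw [Real.dist_eq]
      linarith [neg_abs_le (x - y), hy.1]
    linarith
  · right
    have h3 : 1 < x := not_le.1 fun h3 => hI ⟨h1, h3⟩
    have h2 := hle 1 (by simp)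
    rw [abs_of_pos (by linarith)] at h2
    have : x - 1 ≤ δ := by
      rw [← hδ, Metric.le_infDist hne]
      intro y hy
      rw [Real.dist_eq]
      linarith [le_abs_self (x - y), hy.2]
    linarith

theorem infDist_Icc_of_mem {x r : ℝ} (hx : Metric.infDist x (Icc 0 1) ≤ r) :
    x ∈ Icc (-r) (1 + r) := by
  obtain ⟨y, hy, hxy⟩ := isClosed_Icc.exists_infDist_eq_dist
    (⟨0, by simp⟩ : (Icc (0 : ℝ) 1).Nonempty) x
  rw [hxy, Real.dist_eq, abs_le] at hx
  exact ⟨by linarith [hx.1, hy.1], by linarith [hx.2, hy.2]⟩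

/-- Thickening the first factor alone stays inside the parallel set, and the cube factors have
length `1`. -/
theorem volume_le_volume_cthickening_prodCube {F : Set ℝ} (hF : IsClosed F) (hne : F.Nonempty)
    (n : ℕ) {r : ℝ} (hr : 0 < r) :
    volume (Metric.cthickening r F) ≤ volume (Metric.cthickening r (prodCube (n + 1) F)) := by
  have h1 : box (side (n := n) (Metric.cthickening r F)) ⊆
      Metric.cthickening r (prodCube (n + 1) F) := by
    intro z hz
    rw [prodCube_eq_box, mem_cthickening_iff_infDist_le (nonempty_box (nonempty_side hne)) hr.le,
      infDist_box (isClosed_side hF) (nonempty_side hne), Real.sqrt_le_left hr.le,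
      Fin.sum_univ_succ]
    have h0 : Metric.infDist (z 0) F ≤ r := by
      have := hz 0
      rwa [side_zero, mem_cthickening_iff_infDist_le hne hr.le] at this
    have h2 : ∀ j : Fin n, Metric.infDist (z j.succ) (Icc 0 1) = 0 := fun j => by
      have := hz j.succ
      rw [side_succ] at this
      exact Metric.infDist_zero_of_mem this
    simp only [side_zero, side_succ, h2]
    simpa using pow_le_pow_left₀ Metric.infDist_nonneg h0 2
  refine le_trans (le_of_eq ?_) (measure_mono h1)
  rw [volume_box, Fin.prod_univ_succ]
  simp

/-- The parallel set lies in the product of the parallel sets of the factors, where each cube factor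
has length at most `1 + 2r ≤ 3`. -/
theorem volume_cthickening_prodCube_le {F : Set ℝ} (hF : IsClosed F) (hne : F.Nonempty)
    (n : ℕ) {r : ℝ} (hr : 0 < r) (hr1 : r ≤ 1) :
    volume (Metric.cthickening r (prodCube (n + 1) F)) ≤
      volume (Metric.cthickening r F) * 3 ^ n := by
  have h1 : Metric.cthickening r (prodCube (n + 1) F) ⊆
      box (fun i : Fin (n + 1) => Metric.cthickening r (side F i)) := by
    intro z hz i
    rw [prodCube_eq_box, mem_cthickening_iff_infDist_le (nonempty_box (nonempty_side hne)) hr.le]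
      at hz
    rw [mem_cthickening_iff_infDist_le (nonempty_side hne i) hr.le]
    exact (infDist_coord_le (isClosed_side hF) (nonempty_side hne) z i).trans hz
  refine (measure_mono h1).trans ?_
  rw [volume_box, Fin.prod_univ_succ, side_zero]
  gcongr
  simp only [side_succ, Finset.prod_const, Finset.card_univ, Fintype.card_fin]
  gcongr
  have h2 : Metric.cthickening r (Icc (0 : ℝ) 1) ⊆ Icc (-r) (1 + r) := fun x hx => by
    rw [mem_cthickening_iff_infDist_le ⟨0, by simp⟩ hr.le] at hx
    exact infDist_Icc_of_mem hx
  refine (measure_mono h2).trans ?_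
  rw [Real.volume_Icc, ← ENNReal.ofReal_ofNat]
  exact ENNReal.ofReal_le_ofReal (by linarith)

theorem kappa_pos {t : ℝ} (ht : 0 ≤ t) : 0 < kappa t :=
  div_pos (Real.rpow_pos_of_pos Real.pi_pos _) (Real.Gamma_pos_of_pos (by linarith))

/-- The normalizing constant of the `n`-dimensional Hausdorff measure. -/
noncomputable def hausdorffConst (n : ℕ) : ℝ := kappa n / 2 ^ (n : ℝ)

theorem hausdorffConst_pos (n : ℕ) : 0 < hausdorffConst n :=
  div_pos (kappa_pos n.cast_nonneg) (by positivity)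

theorem surfaceArea_eq {n : ℕ} (A : Set (EuclideanSpace ℝ (Fin (n + 1)))) :
    surfaceArea A = ENNReal.ofReal (hausdorffConst n) *
      Measure.hausdorffMeasure (n : ℝ) (frontier A) := by
  rw [surfaceArea, hausdorffConst]
  push_cast
  simp only [add_sub_cancel_right]

/-- A slice `{c} × [0,1]^n`. -/
def slice (n : ℕ) (c : ℝ) : Set (EuclideanSpace ℝ (Fin (n + 1))) := box (side {c})

/-- Forgetting the first coordinate is 1-Lipschitz into the sup metric and maps the slice onto the
unit cube, of Lebesgue measure `1`. -/
theorem one_le_hausdorffMeasure_slice (n : ℕ) (c : ℝ) :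
    1 ≤ Measure.hausdorffMeasure (n : ℝ) (slice n c) := by
  let f : EuclideanSpace ℝ (Fin (n + 1)) → (Fin n → ℝ) := fun z j => z j.succ
  have hf : LipschitzWith 1 f := LipschitzWith.of_dist_le_mul fun z z' => by
    rw [NNReal.coe_one, one_mul, dist_pi_le_iff dist_nonneg]
    exact fun j => (PiLp.lipschitzWith_ofLp 2 _).dist_le_mul z z' |> fun h => by
      simpa using (dist_le_pi_dist z.ofLp z'.ofLp j.succ).trans h
  have h1 := hf.hausdorffMeasure_image_le n.cast_nonneg (slice n c)
  have h2 : Measure.hausdorffMeasure (n : ℝ) = (volume : Measure (Fin n → ℝ)) := by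
    simpa using hausdorffMeasure_pi_real (ι := Fin n)
  have h3 : Icc (fun _ => 0) (fun _ => 1) ⊆ f '' slice n c := by
    intro y hy
    refine ⟨WithLp.toLp 2 (Fin.cons c y), fun i => ?_, ?_⟩
    · refine Fin.cases ?_ (fun j => ?_) i
      · simp
      · simpa using ⟨hy.1 j, hy.2 j⟩
    · ext j; simp [f]
  have h4 : volume (Icc (fun _ => 0) (fun _ => 1) : Set (Fin n → ℝ)) = 1 := by
    rw [Real.volume_Icc_pi]; simp
  rw [h2] at h1
  simpa [h4] using (measure_mono h3).trans h1

theorem isClosed_box {ι : Type*} [Fintype ι] {S : ι → Set ℝ} (h : ∀ i, IsClosed (S i)) :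
    IsClosed (box S) := by
  simp only [box, ofPred_forall]
  exact isClosed_iInter fun i => (h i).preimage (by fun_prop)

/-! ### Surface and volume of the parallel sets in terms of the lengths. -/

namespace IsPlacement

variable {ι : Type} {l u : ι → ℝ} {a L : ℝ}

/-- Points of the slice are at distance at most `r`, and moving them slightly towards the middle of
the gap makes the distance exceed `r`. -/
theorem slice_subset_frontier (h : IsPlacement l u a L) (n : ℕ) {r : ℝ} (hr : 0 < r) {j : ι}
    (hj : 2 * r < l j) :
    slice n (u j + r) ⊆
      frontier (Metric.cthickening r (prodCube (n + 1) (frontier (union l u)))) := by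
  have hF : IsClosed (frontier (union l u)) := isClosed_frontier
  have hne : (frontier (union l u)).Nonempty := ⟨a, h.left_mem⟩
  intro z hz
  have hz0 : z 0 = u j + r := by simpa using hz 0
  have hmem : ∀ x, x ∈ Metric.cthickening r (prodCube (n + 1) (frontier (union l u))) ↔
      Metric.infDist x (box (side (frontier (union l u)))) ≤ r := fun x => by
    rw [prodCube_eq_box, mem_cthickening_iff_infDist_le (nonempty_box (nonempty_side hne)) hr.le]
  constructor
  · apply subset_closure
    rw [hmem, infDist_box (isClosed_side hF) (nonempty_side hne), Real.sqrt_le_left hr.le,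
      Fin.sum_univ_succ]
    have h2 : ∀ j : Fin n, Metric.infDist (z j.succ) (Icc 0 1) = 0 := fun j => by
      have := hz j.succ
      rw [side_succ] at this
      exact Metric.infDist_zero_of_mem this
    have h3 : Metric.infDist (z 0) (frontier (union l u)) ≤ r := by
      refine (Metric.infDist_le_dist_of_mem (h.gap_left_mem j)).trans ?_
      rw [hz0, Real.dist_eq, add_sub_cancel_left, abs_of_pos hr]
    simp only [side_zero, side_succ, h2]
    simpa using pow_le_pow_left₀ Metric.infDist_nonneg h3 2
  · intro hint
    rw [mem_interior_iff_mem_nhds] at hint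
    have hcont : Continuous fun ε : ℝ => z + ε • EuclideanSpace.single (0 : Fin (n + 1)) (1 : ℝ) :=
      by fun_prop
    have htend : Tendsto (fun ε : ℝ => z + ε • EuclideanSpace.single (0 : Fin (n + 1)) (1 : ℝ))
        (𝓝[>] 0) (𝓝 z) := by
      have := hcont.tendsto 0
      simp only [zero_smul, add_zero] at this
      exact this.mono_left nhdsWithin_le_nhds
    -- For `0 < ε < l j - 2 * r` the point `u j + r + ε` is farther than `r` from both ends of the
    -- gap.
    have hlt : ∀ᶠ ε : ℝ in 𝓝[>] 0, ε ∈ Ioo 0 (l j - 2 * r) :=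
      Ioo_mem_nhdsGT (by linarith)
    obtain ⟨ε, hε, hε1⟩ := ((htend.eventually hint).and hlt).exists
    have h4 := (hmem _).1 hε
    have h5 := (infDist_coord_le (isClosed_side hF) (nonempty_side hne)
      (z + ε • EuclideanSpace.single (0 : Fin (n + 1)) (1 : ℝ)) 0).trans h4
    have h6 := (h.min_le_infDist j (u j + r + ε)).trans (by simpa [hz0] using h5)
    rcases min_le_iff.1 h6 with h7 | h7
    · linarith [hε1.1]
    · linarith [hε1.2]

/-- Every gap longer than `2r` contributes at least a unit cube to the surface. -/
theorem card_le_surfaceArea (h : IsPlacement l u a L) (n : ℕ) {r : ℝ} (hr : 0 < r)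
    (J : Finset ι) (hJ : ∀ j ∈ J, 2 * r < l j) :
    ENNReal.ofReal (hausdorffConst n * J.card) ≤
      surfaceArea (Metric.cthickening r (prodCube (n + 1) (frontier (union l u)))) := by
  rw [surfaceArea_eq, ENNReal.ofReal_mul (hausdorffConst_pos n).le]
  gcongr
  have hdisj : (↑J : Set ι).PairwiseDisjoint fun j => slice n (u j + r) := by
    intro i hi j hj hij
    refine Set.disjoint_left.2 fun z hz hz' => ?_
    have e1 : z 0 = u i + r := by simpa using hz 0
    have e2 : z 0 = u j + r := by simpa using hz' 0
    have hi' := hJ i hi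
    have hj' := hJ j hj
    refine Set.disjoint_left.1 (h.disj hij) (?_ : z 0 ∈ _) ?_
    · rw [e1]; constructor <;> linarith
    · rw [e2]; constructor <;> linarith
  refine le_trans ?_ (measure_mono
    (iUnion₂_subset fun j hj => h.slice_subset_frontier n hr (hJ j hj)))
  rw [measure_biUnion_finset hdisj fun j _ =>
    (isClosed_box (isClosed_side isClosed_singleton)).measurableSet]
  rw [ENNReal.ofReal_natCast]
  simpa using Finset.card_nsmul_le_sum J _ 1 fun j _ => one_le_hausdorffMeasure_slice n (u j + r)

/-- A coordinate realizing a fixed share of the distance is displaced from an endpoint: of `[0,1]`,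
of the enclosing interval, or of a gap. In the last case the distance is at least `r / (n + 1)` and
at most half the gap, hence the condition on `l j`. -/
theorem frontier_subset_pieces (h : IsPlacement l u a L) (n : ℕ) {r : ℝ} (hr : 0 < r) :
    frontier (Metric.cthickening r (prodCube (n + 1) (frontier (union l u)))) ⊆
      ((⋃ i, boundaryPiece (side (frontier (union l u))) r i 0 (-1)) ∪
        ⋃ i : Fin (n + 1), boundaryPiece (side (frontier (union l u))) r i 1 1) ∪
      ((boundaryPiece (side (frontier (union l u))) r 0 a (-1) ∪
        boundaryPiece (side (frontier (union l u))) r 0 (a + L) 1) ∪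
      ⋃ j : {j // 2 * r ≤ (n + 1) * l j},
        (boundaryPiece (side (frontier (union l u))) r 0 (u j) 1 ∪
          boundaryPiece (side (frontier (union l u))) r 0 (u j + l j) (-1))) := by
  have hF : IsClosed (frontier (union l u)) := isClosed_frontier
  have hne : (frontier (union l u)).Nonempty := ⟨a, h.left_mem⟩
  intro z hz
  have h1 := infDist_eq_of_mem_frontier_cthickening hr.le hz
  rw [prodCube_eq_box] at h1
  obtain ⟨i, hi⟩ := exists_le_infDist_coord (isClosed_side hF) (nonempty_side hne) hr h1
  have hpos : 0 < Metric.infDist (z i) (side (frontier (union l u)) i) :=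
    pos_of_mul_pos_right (hr.trans_le hi) (by positivity)
  revert hi hpos
  refine Fin.cases ?_ (fun k => ?_) i
  · intro hi hpos
    right
    rcases h.infDist_cases rfl hpos with h2 | h2 | ⟨j, hj, h2⟩
    · exact Or.inl (Or.inl ⟨h1, hi, by rw [side_zero] at *; linarith⟩)
    · exact Or.inl (Or.inr ⟨h1, hi, by rw [side_zero] at *; linarith⟩)
    · right
      rw [side_zero] at hi
      have hj' : 2 * r ≤ (n + 1) * l j := by
        have : (n + 1) * (2 * Metric.infDist (z 0) (frontier (union l u))) ≤ (n + 1) * l j := by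
          gcongr
        linarith
      refine mem_iUnion.2 ⟨⟨j, hj'⟩, ?_⟩
      rcases h2 with h2 | h2
      · exact Or.inl ⟨h1, by rwa [side_zero], by rw [side_zero]; linarith⟩
      · exact Or.inr ⟨h1, by rwa [side_zero], by rw [side_zero]; linarith⟩
  · intro hi hpos
    left
    rw [side_succ] at hpos
    rcases infDist_Icc_cases rfl hpos with h2 | h2
    · exact Or.inl (mem_iUnion.2 ⟨_, h1, hi, by rw [side_succ]; linarith⟩)
    · exact Or.inr (mem_iUnion.2 ⟨_, h1, hi, by rw [side_succ]; linarith⟩)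

/-- The surface area of the parallel set is at most of the order of the number of gaps of length
at least `2r / (n + 1)`; this number is bounded by `∑' j, w j`. -/
theorem exists_surfaceArea_le (h : IsPlacement l u a L) (n : ℕ) :
    ∃ C : ℝ, 0 < C ∧ ∀ r : ℝ, 0 < r → r ≤ 1 → ∀ w : ι → ℝ, (∀ j, 0 ≤ w j) → Summable w →
      (∀ j, 2 * r ≤ (n + 1) * l j → 1 ≤ w j) →
      surfaceArea (Metric.cthickening r (prodCube (n + 1) (frontier (union l u)))) ≤
        ENNReal.ofReal (C * (1 + ∑' j, w j)) := by
  have hF : IsClosed (frontier (union l u)) := isClosed_frontier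
  have hne : (frontier (union l u)).Nonempty := ⟨a, h.left_mem⟩
  have hcount := h.countable
  set R : ℝ := |a| + L + 1
  have hL := h.length_pos
  have hR0 : 0 ≤ R := by positivity
  have hR : ∀ i : Fin (n + 1), side (frontier (union l u)) i ⊆ Icc (-R) R := by
    intro i
    refine Fin.cases ?_ (fun k => ?_) i
    · rw [side_zero, h.frontier_union]
      refine sdiff_subset.trans (Icc_subset_Icc ?_ ?_)
      · linarith [neg_abs_le a]
      · linarith [le_abs_self a]
    · rw [side_succ]
      refine Icc_subset_Icc ?_ ?_ <;> linarith [abs_nonneg a]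
  set B : ℝ := ((n * (n + 2) : ℕ) : ℝ) ^ n * (2 * (R + 1)) ^ n
  have hB0 : 0 ≤ B := by positivity
  have hB : ∀ r : ℝ, 0 < r → r ≤ 1 → ∀ (i : Fin (n + 1)) (c σ : ℝ), |σ| = 1 →
      Measure.hausdorffMeasure (n : ℝ) (boundaryPiece (side (frontier (union l u))) r i c σ) ≤
        ENNReal.ofReal B := by
    intro r hr hr1 i c σ hσ
    refine (hausdorffMeasure_boundaryPiece_le (isClosed_side hF) (nonempty_side hne) hR hr hr1 i c
      hσ).trans_eq ?_
    rw [← ENNReal.ofReal_natCast, ← ENNReal.ofReal_pow (by positivity),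
      ← ENNReal.ofReal_pow (by positivity), ← ENNReal.ofReal_mul (by positivity)]
  have hκ := hausdorffConst_pos n
  -- There are `2 * (n + 1) + 2` pieces not tied to a gap; the two per gap are absorbed by the
  -- factor in front of the sum. `B + 1` in place of `B` makes positivity immediate.
  refine ⟨hausdorffConst n * (2 * n + 4) * (B + 1), by positivity, fun r hr hr1 w hw0 hws hw => ?_⟩
  have hσ1 : |(-1 : ℝ)| = 1 := by simp
  have hσ2 : |(1 : ℝ)| = 1 := by simp
  have hfin : ∀ c σ : ℝ, |σ| = 1 → Measure.hausdorffMeasure (n : ℝ)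
      (⋃ i : Fin (n + 1), boundaryPiece (side (frontier (union l u))) r i c σ) ≤
        ENNReal.ofReal ((n + 1) * B) := fun c σ hσ => by
    refine (measure_iUnion_le _).trans ?_
    rw [tsum_fintype]
    refine (Finset.sum_le_card_nsmul _ _ _ fun i _ => hB r hr hr1 i c σ hσ).trans_eq ?_
    rw [nsmul_eq_mul, ← ENNReal.ofReal_natCast, ← ENNReal.ofReal_mul (by positivity)]
    simp
  have hinf : Measure.hausdorffMeasure (n : ℝ) (⋃ j : {j // 2 * r ≤ (n + 1) * l j},
        (boundaryPiece (side (frontier (union l u))) r (0 : Fin (n + 1)) (u j) 1 ∪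
          boundaryPiece (side (frontier (union l u))) r 0 (u j + l j) (-1))) ≤
      ENNReal.ofReal (2 * B * ∑' j, w j) := by
    refine (measure_iUnion_le _).trans ?_
    rw [← tsum_mul_left, ENNReal.ofReal_tsum_of_nonneg (fun j => mul_nonneg (by positivity) (hw0 j))
      (hws.mul_left _)]
    refine le_trans (ENNReal.tsum_le_tsum fun j => ?_)
      (ENNReal.tsum_comp_le_tsum_of_injective (Subtype.val_injective (p := fun j =>
        2 * r ≤ (n + 1) * l j)) _)
    refine (measure_union_le _ _).trans ((add_le_add (hB r hr hr1 _ _ _ hσ2)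
      (hB r hr hr1 _ _ _ hσ1)).trans ?_)
    rw [← ENNReal.ofReal_add hB0 hB0]
    refine ENNReal.ofReal_le_ofReal ?_
    nlinarith [hw j j.2]
  have hS : 0 ≤ ∑' j, w j := tsum_nonneg hw0
  rw [surfaceArea_eq, mul_assoc (hausdorffConst n), mul_assoc (hausdorffConst n),
    ENNReal.ofReal_mul hκ.le]
  gcongr
  refine (measure_mono (h.frontier_subset_pieces n hr)).trans ?_
  refine (measure_union_le _ _).trans ((add_le_add ((measure_union_le _ _).trans
    (add_le_add (hfin 0 (-1) hσ1) (hfin 1 1 hσ2))) ((measure_union_le _ _).trans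
    (add_le_add ((measure_union_le _ _).trans (add_le_add (hB r hr hr1 0 a (-1) hσ1)
      (hB r hr hr1 0 (a + L) 1 hσ2))) hinf))).trans ?_)
  rw [← ENNReal.ofReal_add (by positivity) (by positivity), ← ENNReal.ofReal_add hB0 hB0,
    ← ENNReal.ofReal_add (by positivity) (by positivity),
    ← ENNReal.ofReal_add (by positivity) (by positivity)]
  refine ENNReal.ofReal_le_ofReal ?_
  have e1 : 0 ≤ (n : ℝ) * B * ∑' j, w j := by positivity
  have e2 : 0 ≤ B * ∑' j, w j := by positivity
  have e3 : 0 ≤ (n : ℝ) * ∑' j, w j := by positivity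
  have e4 : (0 : ℝ) ≤ n := n.cast_nonneg
  nlinarith

/-- The volume of the parallel set is at least of the order of `∑ min(l_j, r)`. -/
theorem sum_min_le_volume_prodCube (h : IsPlacement l u a L) (n : ℕ) {r : ℝ} (hr : 0 < r)
    (J : Finset ι) :
    ENNReal.ofReal (∑ j ∈ J, min (l j) r) ≤
      volume (Metric.cthickening r (prodCube (n + 1) (frontier (union l u)))) := by
  rw [ENNReal.ofReal_sum_of_nonneg fun j _ => le_min (h.pos j).le hr.le]
  exact (h.sum_min_le_volume J).trans
    (volume_le_volume_cthickening_prodCube isClosed_frontier ⟨a, h.left_mem⟩ n hr)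

/-- The volume of the parallel set is at most of the order of `r + ∑ min(l_j, 2r)`. -/
theorem volume_prodCube_le (h : IsPlacement l u a L) (n : ℕ) {r : ℝ} (hr : 0 < r) (hr1 : r ≤ 1)
    {w : ι → ℝ} (hw : ∀ j, min (l j) (2 * r) ≤ w j) (hs : Summable w) :
    volume (Metric.cthickening r (prodCube (n + 1) (frontier (union l u)))) ≤
      ENNReal.ofReal (3 ^ n * (2 * r + ∑' j, w j)) := by
  refine (volume_cthickening_prodCube_le isClosed_frontier ⟨a, h.left_mem⟩ n hr hr1).trans ?_
  rw [mul_comm, ENNReal.ofReal_mul (by positivity), ENNReal.ofReal_pow (by norm_num),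
    ENNReal.ofReal_ofNat]
  gcongr
  exact h.volume_le hr hw hs

end IsPlacement

/-! ### The lengths and multiplicities of the string. -/

theorem tendsto_rpow_zero {α : Type*} {F : Filter α} {x : α → ℝ} (hx : Tendsto x F (𝓝 0)) {e : ℝ}
    (he : 0 < e) : Tendsto (fun k => x k ^ e) F (𝓝 0) := by
  simpa [Real.zero_rpow he.ne'] using hx.rpow_const (p := e) (Or.inr he.le)

/-- The distinct lengths of the fractal string. -/
noncomputable def ell (s m : ℝ) (k : ℕ) : ℝ := (2 : ℝ) ^ (-(q s m ^ k))

theorem ell_pos (s m : ℝ) (k : ℕ) : 0 < ell s m k := Real.rpow_pos_of_pos two_pos _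

theorem one_lt_q {s m : ℝ} (hs : 0 < s) (hsm : s < m) : 1 < q s m := by
  have := one_div_lt_one_div_of_lt hs hsm
  rw [q]; linarith

theorem s_mul_q {s m : ℝ} (hs : 0 < s) : s * q s m = 1 + s - s / m := by
  rw [q]; field_simp; ring

theorem s_mul_q_lt_one {s m : ℝ} (hs : 0 < s) (hsm : s < m) (hm : m < 1) : s * q s m < 1 := by
  have : s < s / m := by
    rw [lt_div_iff₀ (hs.trans hsm)]; nlinarith
  rw [s_mul_q hs]; linarith

theorem lt_s_mul_q {s m : ℝ} (hs : 0 < s) (hsm : s < m) (hm : m < 1) : m < s * q s m := by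
  have h1 : s / m < 1 := (div_lt_one (hs.trans hsm)).2 hsm
  have h2 : s / m * m = s := div_mul_cancel₀ _ (hs.trans hsm).ne'
  rw [s_mul_q hs]
  nlinarith

theorem ell_succ {s m : ℝ} (k : ℕ) : ell s m (k + 1) = ell s m k ^ q s m := by
  rw [ell, ell, ← Real.rpow_mul two_pos.le, pow_succ]
  ring_nf

theorem multiplicity_le (s m : ℝ) (k : ℕ) : (multiplicity s m k : ℝ) ≤ ell s m k ^ (-(s * q s m)) := by
  refine (Nat.floor_le (by positivity)).trans_eq ?_
  rw [ell, ← Real.rpow_mul two_pos.le, pow_succ]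
  ring_nf

/-- For `t = s` this turns the multiplicity bound `ℓ_k^{-sq}` into `ℓ_{k+1}^{-s}`: the count at
level `k` is measured against the next, much smaller length. -/
theorem ell_rpow_neg (s m : ℝ) (k : ℕ) (t : ℝ) : ell s m k ^ (-(t * q s m)) = ell s m (k + 1) ^ (-t) := by
  rw [ell_succ, ← Real.rpow_mul (ell_pos s m k).le]
  ring_nf

section

variable {s m : ℝ} (hs : 0 < s) (hsm : s < m)
include hs hsm

theorem ell_strictAnti : StrictAnti (ell s m) := fun i j hij => by
  rw [ell, ell, Real.rpow_lt_rpow_left_iff one_lt_two, neg_lt_neg_iff]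
  exact pow_lt_pow_right₀ (one_lt_q hs hsm) hij

theorem ell_le_one (k : ℕ) : ell s m k ≤ 1 := by
  rw [ell]
  refine Real.rpow_le_one_of_one_le_of_nonpos one_le_two ?_
  linarith [pow_pos (one_pos.trans (one_lt_q hs hsm)) k]

/-- Bernoulli: `q ^ k ≥ 1 + k (q - 1)`. -/
theorem ell_rpow_le_geometric {e : ℝ} (he : 0 < e) (k : ℕ) :
    ell s m k ^ e ≤ ((2 : ℝ) ^ (-((q s m - 1) * e))) ^ k := by
  have hq := one_lt_q hs hsm
  have h1 : 1 + k * (q s m - 1) ≤ q s m ^ k := one_add_mul_sub_le_pow (by linarith) k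
  rw [ell, ← Real.rpow_mul two_pos.le, ← Real.rpow_natCast (_ ^ _) k, ← Real.rpow_mul two_pos.le]
  refine Real.rpow_le_rpow_of_exponent_le one_le_two ?_
  nlinarith

theorem summable_ell_rpow {e : ℝ} (he : 0 < e) : Summable fun k => ell s m k ^ e := by
  have hq := one_lt_q hs hsm
  refine Summable.of_nonneg_of_le (fun k => Real.rpow_nonneg (ell_pos s m k).le _)
    (ell_rpow_le_geometric hs hsm he) (summable_geometric_of_lt_one (by positivity) ?_)
  exact Real.rpow_lt_one_of_one_lt_of_neg one_lt_two
    (neg_lt_zero.2 (mul_pos (by linarith) he))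

theorem tendsto_ell : Tendsto (ell s m) atTop (𝓝 0) := by
  simpa using (summable_ell_rpow hs hsm one_pos).tendsto_atTop_zero

/-- For `y ≥ 1` the floor is at least `1`, so `y ≤ ⌊y⌋ + 1 ≤ 2 ⌊y⌋`. -/
theorem le_multiplicity (k : ℕ) :
    ell s m k ^ (-(s * q s m)) / 2 ≤ (multiplicity s m k : ℝ) := by
  have h1 : ell s m k ^ (-(s * q s m)) = (2 : ℝ) ^ (q s m ^ (k + 1) * s) := by
    rw [ell, ← Real.rpow_mul two_pos.le, pow_succ]
    ring_nf
  have hq := one_lt_q hs hsm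
  have h2 : 1 ≤ (2 : ℝ) ^ (q s m ^ (k + 1) * s) :=
    Real.one_le_rpow one_le_two (by positivity)
  have h3 := Nat.lt_floor_add_one ((2 : ℝ) ^ (q s m ^ (k + 1) * s))
  have h4 : (1 : ℝ) ≤ (⌊(2 : ℝ) ^ (q s m ^ (k + 1) * s)⌋₊ : ℝ) := by
    exact_mod_cast Nat.le_floor (by exact_mod_cast h2)
  rw [h1, multiplicity]
  linarith

/-- The levels start at `k = 1`, which is why `r` must be below `ell s m 1`. -/
theorem exists_ell_le {r : ℝ} (hr : 0 < r) (hr1 : r < ell s m 1) :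
    ∃ k, 0 < k ∧ ell s m (k + 1) ≤ r ∧ r < ell s m k := by
  classical
  have hex : ∃ k, ell s m (k + 1) ≤ r := by
    have := ((tendsto_ell hs hsm).comp (tendsto_add_atTop_nat 1)).eventually_le_const hr
    exact this.exists
  refine ⟨Nat.find hex, ?_, Nat.find_spec hex, ?_⟩
  · rw [Nat.find_pos]
    simpa using hr1
  · have h0 : 0 < Nat.find hex := by
      rw [Nat.find_pos]
      simpa using hr1
    have := Nat.find_min hex (Nat.sub_one_lt h0.ne')
    rw [Nat.sub_one_add_one h0.ne'] at this
    exact not_le.1 this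

/-- Level `k` contributes at most `ℓ_k^{β - sq}`. All upper estimates below rest on this sum, by
Markov's inequality or interpolation. -/
theorem summable_fractalString {β : ℝ} (hβ : s * q s m < β) :
    Summable fun j : StringIndex s m => fractalString s m j ^ β := by
  have hnn : ∀ j : StringIndex s m, 0 ≤ fractalString s m j ^ β := fun j =>
    Real.rpow_nonneg (Real.rpow_nonneg two_pos.le _) _
  rw [summable_sigma_of_nonneg hnn]
  refine ⟨fun k => (hasSum_fintype _).summable, ?_⟩
  refine Summable.of_nonneg_of_le (fun k => tsum_nonneg fun _ => hnn _) (fun k => ?_)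
    ((summable_ell_rpow hs hsm (sub_pos.2 hβ)).comp_injective PNat.coe_injective)
  have h1 : ∀ i, fractalString s m ⟨k, i⟩ ^ β = ell s m k ^ β := fun _ => rfl
  simp only [h1, tsum_fintype, Finset.sum_const, Finset.card_univ, Fintype.card_fin, nsmul_eq_mul,
    Function.comp]
  refine (mul_le_mul_of_nonneg_right (multiplicity_le s m k)
    (Real.rpow_nonneg (ell_pos s m k).le _)).trans_eq ?_
  rw [← Real.rpow_add (ell_pos s m k)]
  ring_nf

/-- No length lies strictly between two consecutive `ell`; this makes the gap count small near
`ℓ_{k+1}`. -/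
theorem ell_le_of_lt {k : ℕ} {j : StringIndex s m} (h : ell s m (k + 1) < fractalString s m j) :
    ell s m k ≤ fractalString s m j := by
  have h1 : (j.1 : ℕ) < k + 1 := (ell_strictAnti hs hsm).lt_iff_gt.1 h
  exact (ell_strictAnti hs hsm).antitone (Nat.lt_succ_iff.1 h1)

end

theorem exists_layer (s m : ℝ) {k : ℕ} (hk : 0 < k) : ∃ J : Finset (StringIndex s m),
    J.card = multiplicity s m k ∧ ∀ j ∈ J, fractalString s m j = ell s m k := by
  let f : Fin (multiplicity s m ((⟨k, hk⟩ : ℕ+) : ℕ)) ↪ StringIndex s m :=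
    ⟨fun i => ⟨⟨k, hk⟩, i⟩, fun _ _ h => eq_of_heq (Sigma.mk.inj h).2⟩
  refine ⟨Finset.univ.map f, by simp, fun j hj => ?_⟩
  obtain ⟨i, -, rfl⟩ := Finset.mem_map.1 hj
  rfl

theorem rpow_le_rpow_of_le_one {x a b : ℝ} (hx : 0 < x) (hx1 : x ≤ 1) (h : a ≤ b) :
    x ^ b ≤ x ^ a := Real.rpow_le_rpow_of_exponent_ge hx hx1 h

/-- The parallel sets of `F × [0,1]^n`. -/
def parallel (n : ℕ) (F : Set ℝ) (r : ℝ) : Set (EuclideanSpace ℝ (Fin (n + 1))) :=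
  Metric.cthickening r (prodCube (n + 1) F)

open IsPlacement

/-! ### Power-law bounds for surface and volume, for all small radii or along a sequence. -/

section Estimates

variable {s m : ℝ} {u : StringIndex s m → ℝ} {a L : ℝ}
  (h : IsPlacement (fractalString s m) u a L) (hs : 0 < s) (hsm : s < m) (n : ℕ)
  {t : ℝ}
include h hs hsm

theorem multiplicity_le_surfaceArea {k : ℕ} (hk : 0 < k) {r : ℝ} (hr : 0 < r)
    (hrk : 2 * r < ell s m k) :
    ENNReal.ofReal (hausdorffConst n * (ell s m k ^ (-(s * q s m)) / 2)) ≤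
      surfaceArea (parallel n (frontier (union (fractalString s m) u)) r) := by
  obtain ⟨J, hJ, hJ'⟩ := exists_layer s m hk
  refine le_trans (ENNReal.ofReal_le_ofReal ?_)
    (h.card_le_surfaceArea n hr J fun j hj => by rwa [hJ' j hj])
  rw [hJ]
  exact mul_le_mul_of_nonneg_left (le_multiplicity hs hsm k) (hausdorffConst_pos n).le

theorem multiplicity_mul_le_volume {k : ℕ} (hk : 0 < k) {r : ℝ} (hr : 0 < r) :
    ENNReal.ofReal (ell s m k ^ (-(s * q s m)) / 2 * min (ell s m k) r) ≤
      volume (parallel n (frontier (union (fractalString s m) u)) r) := by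
  obtain ⟨J, hJ, hJ'⟩ := exists_layer s m hk
  refine le_trans (ENNReal.ofReal_le_ofReal ?_) (h.sum_min_le_volume_prodCube n hr J)
  rw [Finset.sum_congr rfl fun j hj => by rw [hJ' j hj], Finset.sum_const, hJ, nsmul_eq_mul]
  exact mul_le_mul_of_nonneg_right (le_multiplicity hs hsm k)
    (le_min (ell_pos s m k).le hr.le)

/-- If `ℓ_{k+1} ≤ 2r < ℓ_k`, level `k` alone gives about `ℓ_{k+1}^{-s} ≥ (2r)^{-s}` slices. -/
theorem eventually_le_surfaceArea (ht : t < s) :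
    ∃ c : ℝ, 0 < c ∧ ∀ᶠ r : ℝ in 𝓝[>] 0, ENNReal.ofReal (c * r ^ (-t)) ≤
      surfaceArea (parallel n (frontier (union (fractalString s m) u)) r) := by
  have hH := hausdorffConst_pos n
  refine ⟨hausdorffConst n * (2 ^ (-s) / 2), by positivity, ?_⟩
  have h0 := ell_pos s m 1
  filter_upwards [Ioo_mem_nhdsGT (by linarith : 0 < ell s m 1 / 2)] with r hr
  obtain ⟨k, hk, hk1, hk2⟩ := exists_ell_le hs hsm (r := 2 * r) (by linarith [hr.1])
    (by linarith [hr.2])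
  refine le_trans (ENNReal.ofReal_le_ofReal ?_) (multiplicity_le_surfaceArea h hs hsm n hk hr.1 hk2)
  have hr1 : r ≤ 1 := by linarith [hr.2, ell_le_one hs hsm 1]
  rw [mul_assoc]
  refine mul_le_mul_of_nonneg_left ?_ hH.le
  have e1 : (2 * r) ^ (-s) ≤ ell s m (k + 1) ^ (-s) :=
    Real.rpow_le_rpow_of_nonpos (ell_pos _ _ _) hk1 (by linarith)
  have e2 : r ^ (-t) ≤ r ^ (-s) := rpow_le_rpow_of_le_one hr.1 hr1 (by linarith)
  rw [Real.mul_rpow two_pos.le hr.1.le, ← ell_rpow_neg] at e1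
  have e3 := mul_le_mul_of_nonneg_left e2 (Real.rpow_nonneg two_pos.le (-s))
  linarith

/-- Levels `k` and `k + 1` bound the volume below by `x^{-s} r / 2` and `x^{1-sq} / 2`. Their
geometric mean with weights `1 - m` and `m` is free of `x` and equals `r^{1-m} / 2`, so one of the
two is at least that. -/
theorem eventually_le_volume (hm : m < 1) (ht : t < m) :
    ∃ c : ℝ, 0 < c ∧ ∀ᶠ r : ℝ in 𝓝[>] 0, ENNReal.ofReal (c * r ^ (1 - t)) ≤
      volume (parallel n (frontier (union (fractalString s m) u)) r) := by
  refine ⟨1 / 2, by norm_num, ?_⟩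
  filter_upwards [Ioo_mem_nhdsGT (ell_pos s m 1)] with r hr
  obtain ⟨k, hk, hk1, hk2⟩ := exists_ell_le hs hsm hr.1 hr.2
  have hm0 := hs.trans hsm
  have hr0 := hr.1
  have hr1 : r ≤ 1 := by linarith [hr.2, ell_le_one hs hsm 1]
  set x := ell s m (k + 1) with hx
  have hx0 : 0 < x := ell_pos _ _ _
  have e1 : r ^ (1 - t) ≤ r ^ (1 - m) := rpow_le_rpow_of_le_one hr.1 hr1 (by linarith)
  have e2 : (x ^ (-s) * r) ^ (1 - m) * (x ^ (1 - s * q s m)) ^ m = r ^ (1 - m) := by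
    rw [Real.mul_rpow (by positivity) hr0.le, ← Real.rpow_mul hx0.le, ← Real.rpow_mul hx0.le,
      mul_right_comm, ← Real.rpow_add hx0]
    have : -s * (1 - m) + (1 - s * q s m) * m = 0 := by
      rw [s_mul_q hs]; field_simp; ring
    rw [this, Real.rpow_zero, one_mul]
  have e3 := Real.geom_mean_le_arith_mean2_weighted (by linarith : 0 ≤ 1 - m) hm0.le
    (by positivity : 0 ≤ x ^ (-s) * r) (by positivity : 0 ≤ x ^ (1 - s * q s m)) (by ring)
  rw [e2] at e3
  have hmax : r ^ (1 - m) ≤ x ^ (-s) * r ∨ r ^ (1 - m) ≤ x ^ (1 - s * q s m) := by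
    by_contra! H
    nlinarith
  rcases hmax with H | H
  · refine le_trans (ENNReal.ofReal_le_ofReal ?_)
      (multiplicity_mul_le_volume h hs hsm n hk hr.1)
    rw [min_eq_right hk2.le, ell_rpow_neg]
    linarith
  · refine le_trans (ENNReal.ofReal_le_ofReal ?_)
      (multiplicity_mul_le_volume h hs hsm n k.succ_pos hr.1)
    rw [min_eq_left hk1, ← hx]
    have : x ^ (1 - s * q s m) = x ^ (-(s * q s m)) * x := by
      rw [← Real.rpow_add_one hx0.ne']; ring_nf
    linarith

theorem exists_seq_le_surfaceArea (ht : t < s * q s m) :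
    ∃ c : ℝ, 0 < c ∧ ∃ r : ℕ → ℝ, Tendsto r atTop (𝓝[>] 0) ∧ ∀ k,
      ENNReal.ofReal (c * r k ^ (-t)) ≤
        surfaceArea (parallel n (frontier (union (fractalString s m) u)) (r k)) := by
  have hH := hausdorffConst_pos n
  -- With `r = ℓ_{k+1} / 4` the gaps of length `ℓ_{k+1}` are strictly longer than `2r`.
  refine ⟨hausdorffConst n * ((1 / 4) ^ t / 2), by positivity,
    fun k => 1 / 4 * ell s m (k + 1), ?_, fun k => ?_⟩
  · refine tendsto_nhdsWithin_iff.2 ⟨?_, Eventually.of_forall fun k => ?_⟩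
    · rw [← mul_zero (1 / 4 : ℝ)]
      exact ((tendsto_ell hs hsm).comp (tendsto_add_atTop_nat 1)).const_mul (1 / 4)
    · exact mul_pos (by norm_num) (ell_pos _ _ _)
  · have h0 := ell_pos s m (k + 1)
    refine le_trans (ENNReal.ofReal_le_ofReal ?_)
      (multiplicity_le_surfaceArea h hs hsm n k.succ_pos (by linarith) (by linarith))
    rw [mul_assoc]
    refine mul_le_mul_of_nonneg_left ?_ hH.le
    have e1 : ell s m (k + 1) ^ (-t) ≤ ell s m (k + 1) ^ (-(s * q s m)) :=
      rpow_le_rpow_of_le_one h0 (ell_le_one hs hsm _) (by linarith)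
    have e2 : (1 / 4 : ℝ) ^ t * (1 / 4) ^ (-t) = 1 := by
      rw [← Real.rpow_add (by norm_num)]; simp
    rw [Real.mul_rpow (by norm_num) h0.le]
    calc (1 / 4 : ℝ) ^ t / 2 * ((1 / 4) ^ (-t) * ell s m (k + 1) ^ (-t))
        = (1 / 4 : ℝ) ^ t * (1 / 4) ^ (-t) * ell s m (k + 1) ^ (-t) / 2 := by ring
      _ ≤ _ := by rw [e2]; linarith

theorem exists_seq_le_volume (ht : t < s * q s m) :
    ∃ c : ℝ, 0 < c ∧ ∃ r : ℕ → ℝ, Tendsto r atTop (𝓝[>] 0) ∧ ∀ k,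
      ENNReal.ofReal (c * r k ^ (1 - t)) ≤
        volume (parallel n (frontier (union (fractalString s m) u)) (r k)) := by
  refine ⟨1 / 2, by norm_num, fun k => ell s m (k + 1), ?_, fun k => ?_⟩
  · exact tendsto_nhdsWithin_iff.2 ⟨(tendsto_ell hs hsm).comp (tendsto_add_atTop_nat 1),
      Eventually.of_forall fun k => ell_pos _ _ _⟩
  · have h0 := ell_pos s m (k + 1)
    refine le_trans (ENNReal.ofReal_le_ofReal ?_)
      (multiplicity_mul_le_volume h hs hsm n k.succ_pos h0)
    have e0 := Real.rpow_add_one h0.ne' (-(s * q s m))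
    rw [min_self, Nat.succ_eq_add_one]
    have e1 : ell s m (k + 1) ^ (1 - t) ≤ ell s m (k + 1) ^ (-(s * q s m) + 1) :=
      rpow_le_rpow_of_le_one h0 (ell_le_one hs hsm _) (by linarith)
    linarith

theorem eventually_surfaceArea_le (ht : s * q s m < t) :
    ∃ g : ℝ → ℝ, Tendsto g (𝓝[>] 0) (𝓝 0) ∧ ∀ᶠ r : ℝ in 𝓝[>] 0,
      surfaceArea (parallel n (frontier (union (fractalString s m) u)) r) ≤
        ENNReal.ofReal (g r * r ^ (-t)) := by
  obtain ⟨β, hβ1, hβ2⟩ := exists_between ht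
  have hq := one_lt_q hs hsm
  have hβ0 : 0 < β := lt_trans (by positivity) hβ1
  obtain ⟨C, hC, hCr⟩ := h.exists_surfaceArea_le n
  have hsum := summable_fractalString hs hsm hβ1
  set Z := ∑' j : StringIndex s m, fractalString s m j ^ β
  -- `ρ * r` is the smallest gap length that counts in `exists_surfaceArea_le`; Markov's inequality
  -- with exponent `β` bounds the number of such gaps by `(ρ * r) ^ (-β) * Z`.
  set ρ : ℝ := 2 / (n + 1)
  have hρ : 0 < ρ := by positivity
  refine ⟨fun r => C * (r ^ t + ρ ^ (-β) * Z * r ^ (t - β)), ?_, ?_⟩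
  · have hid : Tendsto (fun r : ℝ => r) (𝓝[>] 0) (𝓝 0) := nhdsWithin_le_nhds
    simpa using ((tendsto_rpow_zero hid (hβ0.trans hβ2)).add
      ((tendsto_rpow_zero hid (sub_pos.2 hβ2)).const_mul (ρ ^ (-β) * Z))).const_mul C
  · filter_upwards [Ioo_mem_nhdsGT one_pos] with r hr
    have hr0 := hr.1
    refine (hCr r hr.1 hr.2.le (fun j => (ρ * r) ^ (-β) * fractalString s m j ^ β)
      (fun j => ?_) (hsum.mul_left _) fun j hj => ?_).trans_eq ?_
    · have := h.pos j
      positivity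
    · have hle : ρ * r ≤ fractalString s m j := by
        rw [div_mul_eq_mul_div, div_le_iff₀ (by positivity)]; linarith
      have hpos : 0 < ρ * r := by positivity
      calc (1 : ℝ) = (ρ * r) ^ (-β) * (ρ * r) ^ β := by
            rw [← Real.rpow_add hpos]; simp
        _ ≤ _ := by gcongr
    · rw [tsum_mul_left, Real.mul_rpow hρ.le hr0.le]
      congr 1
      have e1 : r ^ t * r ^ (-t) = 1 := by rw [← Real.rpow_add hr0]; simp
      have e2 : r ^ (t - β) * r ^ (-t) = r ^ (-β) := by rw [← Real.rpow_add hr0]; ring_nf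
      calc C * (1 + ρ ^ (-β) * r ^ (-β) * Z)
          = C * (r ^ t * r ^ (-t) + ρ ^ (-β) * (r ^ (t - β) * r ^ (-t)) * Z) := by rw [e1, e2]
        _ = _ := by ring

theorem eventually_volume_le (ht : s * q s m < t) (ht1 : t < 1) :
    ∃ g : ℝ → ℝ, Tendsto g (𝓝[>] 0) (𝓝 0) ∧ ∀ᶠ r : ℝ in 𝓝[>] 0,
      volume (parallel n (frontier (union (fractalString s m) u)) r) ≤
        ENNReal.ofReal (g r * r ^ (1 - t)) := by
  obtain ⟨β, hβ1, hβ2⟩ := exists_between ht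
  have hq := one_lt_q hs hsm
  have hβ0 : 0 < β := lt_trans (by positivity) hβ1
  have hsum := summable_fractalString hs hsm hβ1
  set Z := ∑' j : StringIndex s m, fractalString s m j ^ β
  refine ⟨fun r => 3 ^ n * (2 * r ^ t + 2 ^ (1 - β) * Z * r ^ (t - β)), ?_, ?_⟩
  · have hid : Tendsto (fun r : ℝ => r) (𝓝[>] 0) (𝓝 0) := nhdsWithin_le_nhds
    simpa using (((tendsto_rpow_zero hid (hβ0.trans hβ2)).const_mul 2).add
      ((tendsto_rpow_zero hid (sub_pos.2 hβ2)).const_mul (2 ^ (1 - β) * Z))).const_mul (3 ^ n)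
  · filter_upwards [Ioo_mem_nhdsGT one_pos] with r hr
    have hr0 := hr.1
    -- Interpolation: `min(l, 2r) ≤ (2r)^{1-β} l^β`, valid as `0 < β < 1`.
    refine (h.volume_prodCube_le n hr0 hr.2.le
      (w := fun j => (2 * r) ^ (1 - β) * fractalString s m j ^ β) (fun j => ?_)
      (hsum.mul_left _)).trans_eq ?_
    · have hj := h.pos j
      rcases le_total (fractalString s m j) (2 * r) with H | H
      · refine (min_le_left _ _).trans ?_
        calc fractalString s m j = fractalString s m j ^ (1 - β) * fractalString s m j ^ β := by
              rw [← Real.rpow_add hj]; simp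
          _ ≤ _ := by
            gcongr
            linarith
      · refine (min_le_right _ _).trans ?_
        calc 2 * r = (2 * r) ^ (1 - β) * (2 * r) ^ β := by
              rw [← Real.rpow_add (by positivity)]; simp
          _ ≤ _ := by gcongr
    · rw [tsum_mul_left, Real.mul_rpow two_pos.le hr0.le]
      congr 1
      have e1 : r ^ t * r ^ (1 - t) = r := by rw [← Real.rpow_add hr0]; simp
      have e2 : r ^ (t - β) * r ^ (1 - t) = r ^ (1 - β) := by
        rw [← Real.rpow_add hr0]; ring_nf
      calc 3 ^ n * (2 * r + 2 ^ (1 - β) * r ^ (1 - β) * Z)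
          = 3 ^ n * (2 * (r ^ t * r ^ (1 - t)) +
              2 ^ (1 - β) * (r ^ (t - β) * r ^ (1 - t)) * Z) := by rw [e1, e2]
        _ = _ := by ring

theorem exists_seq_surfaceArea_le (ht : s < t) :
    ∃ r : ℕ → ℝ, Tendsto r atTop (𝓝[>] 0) ∧ ∃ g : ℕ → ℝ, Tendsto g atTop (𝓝 0) ∧
      ∀ᶠ k in atTop, surfaceArea (parallel n (frontier (union (fractalString s m) u)) (r k)) ≤
        ENNReal.ofReal (g k * r k ^ (-t)) := by
  obtain ⟨s', hs1, hs2⟩ := exists_between ht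
  have hq := one_lt_q hs hsm
  have hs0 : 0 < s' := hs.trans hs1
  obtain ⟨C, hC, hCr⟩ := h.exists_surfaceArea_le n
  have hsum := summable_fractalString (m := m) (β := s' * q s m) hs hsm (by gcongr)
  set Z := ∑' j : StringIndex s m, fractalString s m j ^ (s' * q s m)
  have htend : Tendsto (fun k => ell s m (k + 1)) atTop (𝓝 0) :=
    (tendsto_ell hs hsm).comp (tendsto_add_atTop_nat 1)
  have htend' : Tendsto (fun k => (n + 1) * ell s m (k + 1)) atTop (𝓝 0) := by
    simpa using htend.const_mul (n + 1 : ℝ)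
  -- The factor `n + 1` makes every counted gap at least `2 ℓ_{k+1}` long, hence at least `ℓ_k`.
  -- Markov's inequality at `ℓ_k` with exponent `s' * q` then gives a count of at most `Z *
  -- ℓ_{k+1}^{-s'}`.
  refine ⟨fun k => (n + 1) * ell s m (k + 1), tendsto_nhdsWithin_iff.2 ⟨htend',
    Eventually.of_forall fun k => mul_pos (by positivity) (ell_pos _ _ _)⟩,
    fun k => C * (n + 1) ^ t * (ell s m (k + 1) ^ t + Z * ell s m (k + 1) ^ (t - s')), ?_, ?_⟩
  · simpa using ((tendsto_rpow_zero htend (hs.trans ht)).add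
      ((tendsto_rpow_zero htend (sub_pos.2 hs2)).const_mul Z)).const_mul (C * (n + 1) ^ t)
  · filter_upwards [htend'.eventually_le_const one_pos] with k hk
    set x := ell s m (k + 1) with hx
    have hx0 : 0 < x := ell_pos _ _ _
    have hy0 : 0 < ell s m k := ell_pos _ _ _
    refine (hCr _ (by positivity) hk
      (fun j => ell s m k ^ (-(s' * q s m)) * fractalString s m j ^ (s' * q s m))
      (fun j => ?_) (hsum.mul_left _) fun j hj => ?_).trans_eq ?_
    · have := h.pos j
      positivity
    · have hj' : (n + 1 : ℝ) * (2 * x) ≤ (n + 1) * fractalString s m j := by linarith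
      have hlt : x < fractalString s m j := by
        have := le_of_mul_le_mul_left hj' (by positivity)
        linarith
      have hle := ell_le_of_lt hs hsm hlt
      calc (1 : ℝ) = ell s m k ^ (-(s' * q s m)) * ell s m k ^ (s' * q s m) := by
            rw [← Real.rpow_add hy0]; simp
        _ ≤ _ := by gcongr
    · rw [tsum_mul_left, ell_rpow_neg, ← hx, Real.mul_rpow (by positivity) hx0.le]
      congr 1
      have e0 : (n + 1 : ℝ) ^ t * (n + 1 : ℝ) ^ (-t) = 1 := by
        rw [← Real.rpow_add (by positivity)]; simp
      have e1 : x ^ t * x ^ (-t) = 1 := by rw [← Real.rpow_add hx0]; simp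
      have e2 : x ^ (t - s') * x ^ (-t) = x ^ (-s') := by rw [← Real.rpow_add hx0]; ring_nf
      calc C * (1 + x ^ (-s') * Z)
          = C * ((n + 1 : ℝ) ^ t * (n + 1 : ℝ) ^ (-t)) *
              (x ^ t * x ^ (-t) + (x ^ (t - s') * x ^ (-t)) * Z) := by rw [e0, e1, e2]; ring
        _ = _ := by ring

theorem exists_seq_volume_le (ht : m < t) (ht1 : t < 1) :
    ∃ r : ℕ → ℝ, Tendsto r atTop (𝓝[>] 0) ∧ ∃ g : ℕ → ℝ, Tendsto g atTop (𝓝 0) ∧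
      ∀ᶠ k in atTop, volume (parallel n (frontier (union (fractalString s m) u)) (r k)) ≤
        ENNReal.ofReal (g k * r k ^ (1 - t)) := by
  have hq := one_lt_q hs hsm
  have hm0 := hs.trans hsm
  have hp0 : 0 < s / m := div_pos hs hm0
  have hpm : s / m * m = s := div_mul_cancel₀ _ hm0.ne'
  -- The two upper conditions make the exponents of the long and the short gaps in the quotient
  -- positive. At `s' = s` both exponents equal `(s / m) * t - s > 0`, because `1 - s * q = s / m -
  -- s`; so some `s' > s` still works.
  obtain ⟨s', hs1, hs2, hs3⟩ : ∃ s', s < s' ∧ s' < s / m * t ∧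
      s' * q s m < 1 + s / m * (t - 1) := by
    have h1 : s < s / m * t := by nlinarith
    have h2 : s < (1 + s / m * (t - 1)) / q s m := by
      rw [lt_div_iff₀ (by linarith), s_mul_q hs]
      nlinarith
    obtain ⟨s', hs1, hs2⟩ := exists_between (lt_min h1 h2)
    exact ⟨s', hs1, hs2.trans_le (min_le_left _ _),
      (lt_div_iff₀ (by linarith)).1 (hs2.trans_le (min_le_right _ _))⟩
  have hs0 : 0 < s' := hs.trans hs1
  set β := s' * q s m with hβ
  have hβ0 : 0 < β := by positivity
  have hβ1 : β < 1 := by nlinarith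
  have hsum := summable_fractalString (m := m) (β := β) hs hsm (by rw [hβ]; gcongr)
  set Z := ∑' j : StringIndex s m, fractalString s m j ^ β
  set p := s / m
  have htend : Tendsto (fun k => ell s m (k + 1)) atTop (𝓝 0) :=
    (tendsto_ell hs hsm).comp (tendsto_add_atTop_nat 1)
  have ht0 : 0 < t := hm0.trans ht
  refine ⟨fun k => ell s m (k + 1) ^ p, tendsto_nhdsWithin_iff.2 ⟨tendsto_rpow_zero htend hp0,
    Eventually.of_forall fun k => Real.rpow_pos_of_pos (ell_pos _ _ _) _⟩,
    fun k => 3 ^ n * (2 * ell s m (k + 1) ^ (p * t) + (2 * ell s m (k + 1) ^ (p * t - s') +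
      ell s m (k + 1) ^ (1 + p * (t - 1) - β)) * Z), ?_, Eventually.of_forall fun k => ?_⟩
  · simpa using (((tendsto_rpow_zero htend (mul_pos hp0 ht0)).const_mul 2).add
      ((((tendsto_rpow_zero htend (sub_pos.2 hs2)).const_mul 2).add
        (tendsto_rpow_zero htend (sub_pos.2 hs3))).mul_const Z)).const_mul (3 ^ n)
  · set x := ell s m (k + 1) with hx
    have hx0 : 0 < x := ell_pos _ _ _
    have hx1 : x ≤ 1 := ell_le_one hs hsm _
    have hy0 : 0 < ell s m k := ell_pos _ _ _
    refine (h.volume_prodCube_le n (r := x ^ p) (by positivity)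
      (Real.rpow_le_one hx0.le hx1 hp0.le)
      -- The first term handles gaps of length at least `ℓ_k`, where `2r` is multiplied by a Markov
      -- bound; the second interpolates for gaps of length at most `x`.
      (w := fun j => (2 * x ^ p * ell s m k ^ (-β) + x ^ (1 - β)) * fractalString s m j ^ β)
      (fun j => ?_) (hsum.mul_left _)).trans_eq ?_
    · have hj := h.pos j
      rw [add_mul]
      rcases le_or_gt (fractalString s m j) x with H | H
      · refine (min_le_left _ _).trans (le_add_of_nonneg_of_le (by positivity) ?_)
        calc fractalString s m j = fractalString s m j ^ (1 - β) * fractalString s m j ^ β := by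
              rw [← Real.rpow_add hj]; simp
          _ ≤ _ := by
            gcongr
      · refine (min_le_right _ _).trans (le_add_of_le_of_nonneg ?_ (by positivity))
        have hle := ell_le_of_lt hs hsm H
        calc 2 * x ^ p = 2 * x ^ p * (ell s m k ^ (-β) * ell s m k ^ β) := by
              rw [← Real.rpow_add hy0]; simp
          _ = 2 * x ^ p * ell s m k ^ (-β) * ell s m k ^ β := by ring
          _ ≤ _ := by gcongr
    · rw [tsum_mul_left, hβ, ell_rpow_neg, ← hx, ← hβ, ← Real.rpow_mul hx0.le]
      congr 1
      have e1 : x ^ (p * t) * x ^ (p * (1 - t)) = x ^ p := by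
        rw [← Real.rpow_add hx0]; ring_nf
      have e2 : x ^ (p * t - s') * x ^ (p * (1 - t)) = x ^ p * x ^ (-s') := by
        rw [← Real.rpow_add hx0, ← Real.rpow_add hx0]; ring_nf
      have e3 : x ^ (1 + p * (t - 1) - β) * x ^ (p * (1 - t)) = x ^ (1 - β) := by
        rw [← Real.rpow_add hx0]; ring_nf
      linear_combination (-3 ^ n * 2) * e1 + (-3 ^ n * 2 * Z) * e2 + (-3 ^ n * Z) * e3

end Estimates

/-! ### From power-law bounds to contents and dimensions. -/

section Limits

variable {f : ℝ → ENNReal} {K e : ℝ}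

theorem div_le_ofReal_div {x : ENNReal} {g r : ℝ} (hK : 0 < K) (hr : 0 < r)
    (h : x ≤ ENNReal.ofReal (g * r ^ e)) : x / ENNReal.ofReal (K * r ^ e) ≤
      ENNReal.ofReal (g / K) := by
  have hre : 0 < r ^ e := Real.rpow_pos_of_pos hr e
  rw [← mul_div_mul_right g K hre.ne', ENNReal.ofReal_div_of_pos (by positivity)]
  exact ENNReal.div_le_div_right h _

theorem ofReal_div_le_div {x : ENNReal} {c r : ℝ} (hK : 0 < K) (hr : 0 < r)
    (h : ENNReal.ofReal (c * r ^ e) ≤ x) :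
    ENNReal.ofReal (c / K) ≤ x / ENNReal.ofReal (K * r ^ e) := by
  have hre : 0 < r ^ e := Real.rpow_pos_of_pos hr e
  rw [← mul_div_mul_right c K hre.ne', ENNReal.ofReal_div_of_pos (by positivity)]
  exact ENNReal.div_le_div_right h _

theorem tendsto_ofReal_div {α : Type*} {F : Filter α} {g : α → ℝ} (hg : Tendsto g F (𝓝 0)) :
    Tendsto (fun r => ENNReal.ofReal (g r / K)) F (𝓝 0) := by
  simpa using ENNReal.tendsto_ofReal (hg.div_const K)

theorem liminf_div_eq_zero (hK : 0 < K)
    (h : ∃ r : ℕ → ℝ, Tendsto r atTop (𝓝[>] 0) ∧ ∃ g : ℕ → ℝ, Tendsto g atTop (𝓝 0) ∧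
      ∀ᶠ k in atTop, f (r k) ≤ ENNReal.ofReal (g k * r k ^ e)) :
    liminf (fun r => f r / ENNReal.ofReal (K * r ^ e)) (𝓝[>] 0) = 0 := by
  obtain ⟨r, hr, g, hg, hfg⟩ := h
  have h1 : Tendsto (fun k => f (r k) / ENNReal.ofReal (K * r k ^ e)) atTop (𝓝 0) := by
    refine tendsto_of_tendsto_of_tendsto_of_le_of_le' tendsto_const_nhds
      (tendsto_ofReal_div (K := K) hg) (Eventually.of_forall fun _ => zero_le) ?_
    filter_upwards [hfg, hr.eventually self_mem_nhdsWithin] with k hk hk'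
    exact div_le_ofReal_div hK hk' hk
  refine le_antisymm ?_ zero_le
  rw [← h1.liminf_eq]
  -- Passing to a sequence of radii can only raise the liminf.
  exact liminf_le_liminf_of_le (f := 𝓝[>] 0) (g := Filter.map r atTop) hr

theorem limsup_div_eq_zero (hK : 0 < K)
    (h : ∃ g : ℝ → ℝ, Tendsto g (𝓝[>] 0) (𝓝 0) ∧
      ∀ᶠ r in 𝓝[>] 0, f r ≤ ENNReal.ofReal (g r * r ^ e)) :
    limsup (fun r => f r / ENNReal.ofReal (K * r ^ e)) (𝓝[>] 0) = 0 := by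
  obtain ⟨g, hg, hfg⟩ := h
  refine Tendsto.limsup_eq (tendsto_of_tendsto_of_tendsto_of_le_of_le' tendsto_const_nhds
    (tendsto_ofReal_div (K := K) hg) (Eventually.of_forall fun _ => zero_le) ?_)
  filter_upwards [hfg, self_mem_nhdsWithin] with r hr hr'
  exact div_le_ofReal_div hK hr' hr

theorem liminf_div_ne_zero (hK : 0 < K)
    (h : ∃ c : ℝ, 0 < c ∧ ∀ᶠ r in 𝓝[>] 0, ENNReal.ofReal (c * r ^ e) ≤ f r) :
    liminf (fun r => f r / ENNReal.ofReal (K * r ^ e)) (𝓝[>] 0) ≠ 0 := by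
  obtain ⟨c, hc, hcf⟩ := h
  have h1 : ENNReal.ofReal (c / K) ≤
      liminf (fun r => f r / ENNReal.ofReal (K * r ^ e)) (𝓝[>] 0) := by
    refine le_liminf_of_le (by isBoundedDefault) ?_
    filter_upwards [hcf, self_mem_nhdsWithin] with r hr hr'
    exact ofReal_div_le_div hK hr' hr
  exact ((ENNReal.ofReal_pos.2 (div_pos hc hK)).trans_le h1).ne'

theorem limsup_div_ne_zero (hK : 0 < K)
    (h : ∃ c : ℝ, 0 < c ∧ ∃ r : ℕ → ℝ, Tendsto r atTop (𝓝[>] 0) ∧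
      ∀ k, ENNReal.ofReal (c * r k ^ e) ≤ f (r k)) :
    limsup (fun r => f r / ENNReal.ofReal (K * r ^ e)) (𝓝[>] 0) ≠ 0 := by
  obtain ⟨c, hc, r, hr, hcf⟩ := h
  have h1 : ENNReal.ofReal (c / K) ≤
      limsup (fun r => f r / ENNReal.ofReal (K * r ^ e)) (𝓝[>] 0) := by
    refine le_limsup_of_frequently_le (hr.frequently (Eventually.frequently ?_))
    filter_upwards [hr.eventually self_mem_nhdsWithin] with k hk
    exact ofReal_div_le_div hK hk (hcf k)
  exact ((ENNReal.ofReal_pos.2 (div_pos hc hK)).trans_le h1).ne'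

end Limits

/-- Only values just above `D` matter, so upper estimates are needed only below the ambient
dimension, where the normalizing constants are positive. `D < D'` also makes the set nonempty, which
matters as `sInf ∅ = 0`. -/
theorem sInf_eq_of_threshold {P : ℝ → Prop} {D D' : ℝ} (hD : D < D') (h1 : ∀ t, t < D → ¬ P t)
    (h2 : ∀ t, D < t → t < D' → P t) : sInf {t | P t} = D := by
  refine csInf_eq_of_forall_ge_of_forall_gt_exists_lt ?_ (fun t ht => not_lt.1 fun h => h1 t h ht)
    fun w hw => ?_
  · obtain ⟨t, ht, ht'⟩ := exists_between hD
    exact ⟨t, h2 t ht ht'⟩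
  · obtain ⟨t, ht, ht'⟩ := exists_between (lt_min hw hD)
    exact ⟨t, h2 t ht (ht'.trans_le (min_le_right _ _)), ht'.trans_le (min_le_left _ _)⟩

section Dimensions

variable (n : ℕ) (F : Set ℝ)

theorem minkowskiQuotient_eq (T : ℝ) :
    minkowskiQuotient (prodCube (n + 1) F) T = fun r => volume (parallel n F r) /
      ENNReal.ofReal (kappa (1 - (T - n)) * r ^ (1 - (T - n))) := by
  ext r
  have : ((n + 1 : ℕ) : ℝ) - T = 1 - (T - n) := by push_cast; ring
  rw [minkowskiQuotient, this, parallel]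

theorem sQuotient_eq (T : ℝ) :
    sQuotient (prodCube (n + 1) F) T = fun r => surfaceArea (parallel n F r) /
      ENNReal.ofReal ((1 - (T - n)) * kappa (1 - (T - n)) * r ^ (-(T - n))) := by
  ext r
  have h1 : ((n + 1 : ℕ) : ℝ) - T = 1 - (T - n) := by push_cast; ring
  have h2 : ((n + 1 : ℕ) : ℝ) - 1 - T = -(T - n) := by push_cast; ring
  rw [sQuotient, h1, h2, parallel]

variable {n F} {D : ℝ}

theorem lowerMinkowskiDim_eq (hD0 : 0 ≤ D) (hD1 : D < 1)
    (h1 : ∀ t < D, ∃ c : ℝ, 0 < c ∧ ∀ᶠ r : ℝ in 𝓝[>] 0,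
      ENNReal.ofReal (c * r ^ (1 - t)) ≤ volume (parallel n F r))
    (h2 : ∀ t, D < t → t < 1 → ∃ r : ℕ → ℝ, Tendsto r atTop (𝓝[>] 0) ∧ ∃ g : ℕ → ℝ,
      Tendsto g atTop (𝓝 0) ∧
      ∀ᶠ k in atTop, volume (parallel n F (r k)) ≤ ENNReal.ofReal (g k * r k ^ (1 - t))) :
    lowerMinkowskiDim (prodCube (n + 1) F) = D + n := by
  have hn : (0 : ℝ) ≤ n := n.cast_nonneg
  refine sInf_eq_of_threshold (D' := 1 + n) (by linarith) (fun T hT hP => ?_) fun T hT hT' => ?_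
  · have h3 := hP.2
    rw [lowerMinkowskiContent, minkowskiQuotient_eq] at h3
    exact liminf_div_ne_zero (kappa_pos (by linarith)) (h1 (T - n) (by linarith)) h3
  · refine ⟨by linarith, ?_⟩
    rw [lowerMinkowskiContent, minkowskiQuotient_eq]
    exact liminf_div_eq_zero (kappa_pos (by linarith)) (h2 (T - n) (by linarith) (by linarith))

theorem upperMinkowskiDim_eq (hD0 : 0 ≤ D) (hD1 : D < 1)
    (h1 : ∀ t < D, ∃ c : ℝ, 0 < c ∧ ∃ r : ℕ → ℝ, Tendsto r atTop (𝓝[>] 0) ∧ ∀ k,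
      ENNReal.ofReal (c * r k ^ (1 - t)) ≤ volume (parallel n F (r k)))
    (h2 : ∀ t, D < t → t < 1 → ∃ g : ℝ → ℝ, Tendsto g (𝓝[>] 0) (𝓝 0) ∧
      ∀ᶠ r : ℝ in 𝓝[>] 0, volume (parallel n F r) ≤ ENNReal.ofReal (g r * r ^ (1 - t))) :
    upperMinkowskiDim (prodCube (n + 1) F) = D + n := by
  have hn : (0 : ℝ) ≤ n := n.cast_nonneg
  refine sInf_eq_of_threshold (D' := 1 + n) (by linarith) (fun T hT hP => ?_) fun T hT hT' => ?_
  · have h3 := hP.2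
    rw [upperMinkowskiContent, minkowskiQuotient_eq] at h3
    exact limsup_div_ne_zero (kappa_pos (by linarith)) (h1 (T - n) (by linarith)) h3
  · refine ⟨by linarith, ?_⟩
    rw [upperMinkowskiContent, minkowskiQuotient_eq]
    exact limsup_div_eq_zero (kappa_pos (by linarith)) (h2 (T - n) (by linarith) (by linarith))

theorem lowerSDim_eq (hD0 : 0 ≤ D) (hD1 : D < 1)
    (h1 : ∀ t < D, ∃ c : ℝ, 0 < c ∧ ∀ᶠ r : ℝ in 𝓝[>] 0,
      ENNReal.ofReal (c * r ^ (-t)) ≤ surfaceArea (parallel n F r))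
    (h2 : ∀ t, D < t → ∃ r : ℕ → ℝ, Tendsto r atTop (𝓝[>] 0) ∧ ∃ g : ℕ → ℝ,
      Tendsto g atTop (𝓝 0) ∧
      ∀ᶠ k in atTop, surfaceArea (parallel n F (r k)) ≤ ENNReal.ofReal (g k * r k ^ (-t))) :
    lowerSDim (prodCube (n + 1) F) = D + n := by
  have hn : (0 : ℝ) ≤ n := n.cast_nonneg
  refine sInf_eq_of_threshold (D' := 1 + n) (by linarith) (fun T hT hP => ?_) fun T hT hT' => ?_
  · have h3 := hP.2.2
    rw [lowerSContent, if_neg (by push_cast; linarith), sQuotient_eq] at h3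
    exact liminf_div_ne_zero (mul_pos (by linarith) (kappa_pos (by linarith)))
      (h1 (T - n) (by linarith)) h3
  · refine ⟨by linarith, by push_cast; linarith, ?_⟩
    rw [lowerSContent, if_neg (by push_cast; linarith), sQuotient_eq]
    exact liminf_div_eq_zero (mul_pos (by linarith) (kappa_pos (by linarith)))
      (h2 (T - n) (by linarith))

theorem upperSDim_eq (hD0 : 0 ≤ D) (hD1 : D < 1)
    (h1 : ∀ t < D, ∃ c : ℝ, 0 < c ∧ ∃ r : ℕ → ℝ, Tendsto r atTop (𝓝[>] 0) ∧ ∀ k,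
      ENNReal.ofReal (c * r k ^ (-t)) ≤ surfaceArea (parallel n F (r k)))
    (h2 : ∀ t, D < t → ∃ g : ℝ → ℝ, Tendsto g (𝓝[>] 0) (𝓝 0) ∧
      ∀ᶠ r : ℝ in 𝓝[>] 0, surfaceArea (parallel n F r) ≤ ENNReal.ofReal (g r * r ^ (-t))) :
    upperSDim (prodCube (n + 1) F) = D + n := by
  have hn : (0 : ℝ) ≤ n := n.cast_nonneg
  refine sInf_eq_of_threshold (D' := 1 + n) (by linarith) (fun T hT hP => ?_) fun T hT hT' => ?_
  · have h3 := hP.2.2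
    rw [upperSContent, if_neg (by push_cast; linarith), sQuotient_eq] at h3
    exact limsup_div_ne_zero (mul_pos (by linarith) (kappa_pos (by linarith)))
      (h1 (T - n) (by linarith)) h3
  · refine ⟨by linarith, by push_cast; linarith, ?_⟩
    rw [upperSContent, if_neg (by push_cast; linarith), sQuotient_eq]
    exact limsup_div_eq_zero (mul_pos (by linarith) (kappa_pos (by linarith)))
      (h2 (T - n) (by linarith))

end Dimensions

/-! ### Existence of a realization, and the theorem. -/

/-- Every summable countable family of positive lengths has a geometric realization. -/
theorem exists_isGeometricRealization {ι : Type} [Countable ι] {l : ι → ℝ} (hpos : ∀ j, 0 < l j)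
    (hsum : Summable l) : ∃ Ω, IsGeometricRealization l Ω := by
  classical
  obtain ⟨e, he⟩ := exists_injective_nat ι
  -- Intervals are laid end to end in the order of an injection into `ℕ`: `u j` is the total length
  -- of those preceding `j`.
  let v : ι → ι → ℝ := fun j i => if e i < e j then l i else 0
  have hv0 : ∀ j i, 0 ≤ v j i := fun j i => by
    simp only [v]; split_ifs; exacts [(hpos i).le, le_rfl]
  have hvl : ∀ j i, v j i ≤ l i := fun j i => by
    simp only [v]; split_ifs; exacts [le_rfl, (hpos i).le]
  have hvs : ∀ j, Summable (v j) := fun j => hsum.of_nonneg_of_le (hv0 j) (hvl j)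
  let u : ι → ℝ := fun j => ∑' i, v j i
  -- The right endpoint as a single series, so that the comparisons below are termwise.
  have hend : ∀ j, u j + l j = ∑' i, (v j i + if i = j then l j else 0) := fun j => by
    rw [(hvs j).tsum_add (summable_of_hasFiniteSupport ((finite_singleton j).subset (by
      intro i; simp +contextual)))]
    simp [u]
  have hends : ∀ j, Summable fun i => v j i + if i = j then l j else 0 := fun j =>
    (hvs j).add (summable_of_hasFiniteSupport ((finite_singleton j).subset (by
      intro i; simp +contextual)))
  have hle : ∀ j, u j + l j ≤ ∑' i, l i := fun j => by
    rw [hend]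
    refine (hends j).tsum_le_tsum (fun i => ?_) hsum
    by_cases hij : i = j
    · simp [v, hij]
    · simpa [hij] using hvl j i
  have hlt : ∀ i j, e i < e j → u i + l i ≤ u j := fun i j hij => by
    rw [hend]
    refine (hends i).tsum_le_tsum (fun k => ?_) (hvs j)
    by_cases hk : k = i
    · simp [v, hk, hij]
    · simp only [hk, if_false, add_zero, v]
      by_cases hki : e k < e i
      · simp [hki, hki.trans hij]
      · rw [if_neg hki]; exact hv0 j k
  refine ⟨⋃ j, Ioo (u j) (u j + l j), 0, ∑' i, l i, u, hsum.hasSum, fun j => ?_, fun i j hij => ?_,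
    rfl⟩
  · refine Ioo_subset_Ioo (tsum_nonneg (hv0 j)) ?_
    rw [zero_add]; exact hle j
  · refine Set.disjoint_left.2 fun x hx hx' => ?_
    rcases lt_or_gt_of_ne (he.ne hij) with H | H
    · linarith [hlt i j H, hx.2, hx'.1]
    · linarith [hlt j i H, hx.1, hx'.2]

end SDim

open SDim in
theorem theorem2p2 (s m : ℝ) (hs : 0 < s) (hsm : s < m) (hm : m < 1) (d : ℕ) (hd : 1 ≤ d) :
    (∃ Ω : Set ℝ, SDim.IsGeometricRealization (SDim.fractalString s m) Ω) ∧
    ∀ Ω : Set ℝ, SDim.IsGeometricRealization (SDim.fractalString s m) Ω →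
      SDim.lowerSDim (SDim.prodCube d (frontier Ω)) = s + d - 1 ∧
      SDim.lowerMinkowskiDim (SDim.prodCube d (frontier Ω)) = m + d - 1 ∧
      SDim.upperMinkowskiDim (SDim.prodCube d (frontier Ω)) = s * SDim.q s m + d - 1 ∧
      SDim.upperSDim (SDim.prodCube d (frontier Ω)) = s * SDim.q s m + d - 1 ∧
      s * SDim.q s m + d - 1 = d + s - s / m := by
  have hpos : ∀ j, 0 < fractalString s m j := fun j => Real.rpow_pos_of_pos two_pos _
  have hsq1 := s_mul_q_lt_one hs hsm hm
  have hmsq := lt_s_mul_q hs hsm hm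
  obtain ⟨n, rfl⟩ : ∃ n, d = n + 1 := ⟨d - 1, by omega⟩
  have hcast : ∀ x : ℝ, x + ((n + 1 : ℕ) : ℝ) - 1 = x + n := fun x => by push_cast; ring
  refine ⟨exists_isGeometricRealization hpos ?_, ?_⟩
  · simpa using summable_fractalString hs hsm hsq1
  rintro Ω ⟨a, L, u, hL, hsub, hdisj, rfl⟩
  have hne : Nonempty (StringIndex s m) := by
    have h1 : 0 < multiplicity s m 1 := by
      have := (div_pos (Real.rpow_pos_of_pos (ell_pos s m 1) _) two_pos).trans_le
        (le_multiplicity hs hsm 1)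
      exact_mod_cast this
    exact ⟨⟨1, ⟨0, h1⟩⟩⟩
  have h : IsPlacement (fractalString s m) u a L :=
    ⟨hne, inferInstance, hpos, hL, hsub, hdisj⟩
  simp only [hcast]
  refine ⟨?_, ?_, ?_, ?_, ?_⟩
  · exact lowerSDim_eq hs.le (by linarith) (fun t ht => eventually_le_surfaceArea h hs hsm n ht)
      fun t ht => exists_seq_surfaceArea_le h hs hsm n ht
  · exact lowerMinkowskiDim_eq (by linarith) hm
      (fun t ht => eventually_le_volume h hs hsm n hm ht)
      fun t ht ht1 => exists_seq_volume_le h hs hsm n ht ht1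
  · exact upperMinkowskiDim_eq (by linarith) hsq1
      (fun t ht => exists_seq_le_volume h hs hsm n ht)
      fun t ht ht1 => eventually_volume_le h hs hsm n ht ht1
  · exact upperSDim_eq (by linarith) hsq1
      (fun t ht => exists_seq_le_surfaceArea h hs hsm n ht)
      fun t ht => eventually_surfaceArea_le h hs hsm n ht
  · rw [s_mul_q hs]; push_cast; ring
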